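/- Let $G$ be a Lie group acting smoothly on the left on a (finite-dimensional) smooth manifold $Q$, so that $\pi:Q\to Q/G$ is a smooth principal bundle with structure group $G$, and let $\mathfrak g$ be the Lie algebra of $G$; $\xi_Q(q)\in T_qQ$ denotes the infinitesimal generator of $\xi\in\mathfrak g$ at $q$. Let $(Q,L_d,f_d)$ be a forced discrete mechanical system with symmetry group $G$: $L_d:Q\times Q\to\mathbb R$ is a smooth $G$-invariant function and $f_d$ is a smooth $1$-form on $Q\times Q$ which is $G$-equivariant as a section of $T^*(Q\times Q)$ (for the diagonal action). Write $f_d(q_0,q_1)(\delta q_0,\delta q_1)=f_d^-(q_0,q_1)(\delta q_0)+f_d^+(q_0,q_1)(\delta q_1)$. Fix a principal connection $\mathfrak A$ on $\pi$, with horizontal lift $h^q:T_{\pi(q)}(Q/G)\to T_qQ$, and an affine discrete connection on $\pi$ defined on all of $Q\times Q$: for some smooth level function $\gamma:Q\to G$ with $\gamma(gq)=g\gamma(q)g^{-1}$, a $G$-invariant (for the diagonal action) embedded submanifold $\mathrm{Hor}\subseteq Q\times Q$ that contains $\{(q,\gamma(q)q):q\in Q\}$, such that $\mathrm{id}_Q\times\pi$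 restricts to an injective local diffeomorphism $\mathrm{Hor}\to Q\times Q/G$, and such that for all $(q_0,q_1)\in Q\times Q$ there is $g\in G$ with $(q_0,g^{-1}q_1)\in\mathrm{Hor}$. This $g$ is unique and is denoted $\mathcal A_d(q_0,q_1)$; this defines $\mathcal A_d:Q\times Q\to G$. Let $\tilde G:=(Q\times G)/G$ be the quotient for the action $g\cdot(q,w)=(gq,gwg^{-1})$, with quotient map $\rho:Q\times G\to\tilde G$, and put $\Upsilon(q_0,q_1):=(\rho(q_0,\mathcal A_d(q_0,q_1)),\pi(q_1))\in\tilde G\times Q/G$. Let $\tilde\Psi:Q\times G\times Q/G\to Q\times Q$ be the inverse of the diffeomorphism $(q_0,q_1)\mapsto(q_0,\mathcal A_d(q_0,q_1),\pi(q_1))$. Put $\check L_d:=L_d\circ\tilde\Psi$ and $\check f_d:=\tilde\Psi^*f_d$, with components $\check f_d=\check f_d^1+\check f_d^2+\check f_d^3$ along the three factors, and let $\hat L_d:\tilde G\times Q/G\to\mathbb R$ be given by $\hat L_d(\rho(q,w),\tau):=\check L_d(q,w,\tau)$. Let $(Q\times Q\times\mathfrak g)/G$ be the adjoint bundle of $Q\times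 Q\to(Q\times Q)/G$, for the action $g\cdot((q_0,q_1),\xi)=((gq_0,gq_1),\mathrm{Ad}_g\xi)$. The reduced force is given by $$\hat f_d(v,\tau)\big((\delta v,\delta\tau)\oplus[(q_0,q_1),\xi]\big):=f_d(q_0,q_1)(\delta q_0,\delta q_1)$$ whenever $\Upsilon(q_0,q_1)=(v,\tau)$, $T_{(q_0,q_1)}\Upsilon(\delta q_0,\delta q_1)=(\delta v,\delta\tau)$ and $\tfrac12(\mathfrak A(\delta q_0)+\mathfrak A(\delta q_1))=\xi$. For $\alpha\in T^*_wG$ let $\alpha w^{-1}\in\mathfrak g^*$ be given by $(\alpha w^{-1})(\xi):=\alpha(T_eR_w\,\xi)$, where $R_w$ is right translation by $w$. $D_i$ denotes the differential with respect to the $i$-th variable. Let $q_\cdot=(q_0,\dots,q_N)$ be a discrete curve in $Q$, and let $\tau_k:=\pi(q_k)$ for $0\le k\le N$, and $w_k:=\mathcal A_d(q_k,q_{k+1})$, $v_k:=\rho(q_k,w_k)$ for $0\le k\le N-1$. Then the following statements are equivalent. 1. (Discrete Lagrange–d'Alembert principle.) With $S_d(q_\cdot):=\sum_{k=0}^{N-1}L_d(q_k,q_{k+1})$,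 $$dS_d(q_\cdot)(\delta q_\cdot)+\sum_{k=0}^{N-1}f_d(q_k,q_{k+1})(\delta q_k,\delta q_{k+1})=0$$ for all $\delta q_k\in T_{q_k}Q$ ($0\le k\le N$) with $\delta q_0=0$ and $\delta q_N=0$. 2. (Forced discrete Euler–Lagrange equations.) For all $1\le k\le N-1$, $$D_2L_d(q_{k-1},q_k)+D_1L_d(q_k,q_{k+1})+f_d^+(q_{k-1},q_k)+f_d^-(q_k,q_{k+1})=0\in T^*_{q_k}Q.$$ 3. (Reduced variational principle.) With $\hat S_d((v_0,\tau_1),\dots,(v_{N-1},\tau_N)):=\sum_{k=0}^{N-1}\hat L_d(v_k,\tau_{k+1})$, $$d\hat S_d(v_\cdot,\tau_\cdot)(\delta v_\cdot,\delta\tau_\cdot)+\sum_{k=0}^{N-1}\hat f_d(v_k,\tau_{k+1})\Big((\delta v_k,\delta\tau_{k+1})\oplus\big[(q_k,q_{k+1}),\tfrac12(\xi_k+\xi_{k+1})\big]\Big)=0$$ for all $\delta\tau_k\in T_{\tau_k}(Q/G)$ and $\xi_k\in\mathfrak g$ ($0\le k\le N$) with $\delta\tau_0=0$, $\delta\tau_N=0$,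 $\xi_0=\xi_N=0$, and $$\begin{aligned}\delta v_k={}&T_{(q_k,w_k)}\rho\big(h^{q_k}(\delta\tau_k),T_{(q_k,q_{k+1})}\mathcal A_d(h^{q_k}(\delta\tau_k),h^{q_{k+1}}(\delta\tau_{k+1}))\big)\\&+T_{(q_k,w_k)}\rho\big((\xi_k)_Q(q_k),T_{(q_k,q_{k+1})}\mathcal A_d((\xi_k)_Q(q_k),(\xi_{k+1})_Q(q_{k+1}))\big)\end{aligned}$$ for $0\le k\le N-1$. 4. (Reduced equations.) For all $1\le k\le N-1$, $\phi_{f_d}=0$ in $T^*_{\tau_k}(Q/G)$ and $\psi_{f_d}(\xi)=0$ for all $\xi\in\mathfrak g$, where $$\begin{aligned}\phi_{f_d}:={}&D_1\check L_d(q_k,w_k,\tau_{k+1})\circ h^{q_k}+D_3\check L_d(q_{k-1},w_{k-1},\tau_k)\\&+D_2\check L_d(q_k,w_k,\tau_{k+1})\,D_1\mathcal A_d(q_k,q_{k+1})\circ h^{q_k}+D_2\check L_d(q_{k-1},w_{k-1},\tau_k)\,D_2\mathcal A_d(q_{k-1},q_k)\circ h^{q_k}\\&+\check f_d^1(q_k,w_k,\tau_{k+1})\circ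 h^{q_k}+\check f_d^3(q_{k-1},w_{k-1},\tau_k)\\&+\check f_d^2(q_k,w_k,\tau_{k+1})\,D_1\mathcal A_d(q_k,q_{k+1})\circ h^{q_k}+\check f_d^2(q_{k-1},w_{k-1},\tau_k)\,D_2\mathcal A_d(q_{k-1},q_k)\circ h^{q_k},\\ \psi_{f_d}(\xi):={}&\big(D_2\check L_d(q_{k-1},w_{k-1},\tau_k)w_{k-1}^{-1}-D_2\check L_d(q_k,w_k,\tau_{k+1})w_k^{-1}\big)(\xi)\\&+\big(\check f_d^1(q_k,w_k,\tau_{k+1})+\check f_d^2(q_k,w_k,\tau_{k+1})D_1\mathcal A_d(q_k,q_{k+1})+\check f_d^2(q_{k-1},w_{k-1},\tau_k)D_2\mathcal A_d(q_{k-1},q_k)\big)(\xi_Q(q_k)).\end{aligned}$$ -/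

import Mathlib

open scoped Manifold ContDiff Topology

set_option linter.unusedSectionVars false
set_option linter.unusedVariables false

noncomputable section

namespace DiscreteReduction

/-! ### Principal bundles

Manifolds are modelled on finite-dimensional real vector spaces: `Q` on `EQ`, the orbit space
`Q / G` on `EB`, and the Lie group `G` on `EG`.  "Smooth" means `C^∞`. -/

/-- The orbit space `Q / G`, with the quotient topology. -/
abbrev Base (G Q : Type*) [Group G] [MulAction G Q] : Type _ := MulAction.orbitRel.Quotient G Q

/-- The projection `π : Q → Q / G`. -/
def proj (G : Type*) {Q : Type*} [Group G] [MulAction G Q] (q : Q) : Base G Q :=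
  Quotient.mk (MulAction.orbitRel G Q) q

section Bundle

variable (EQ EB EG G Q : Type*)
  [NormedAddCommGroup EQ] [NormedSpace ℝ EQ]
  [NormedAddCommGroup EB] [NormedSpace ℝ EB]
  [NormedAddCommGroup EG] [NormedSpace ℝ EG]
  [TopologicalSpace Q] [ChartedSpace EQ Q]
  [Group G] [TopologicalSpace G] [ChartedSpace EG G]
  [MulAction G Q] [ChartedSpace EB (Base G Q)]

/-- A local trivialization of `π : Q → Q / G` over an open set `baseSet`: a `G`-equivariant
diffeomorphism `π⁻¹(baseSet) → baseSet × G` over `baseSet`, `G` acting on `G` by left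
translations. -/
structure LocalTriv extends OpenPartialHomeomorph Q (Base G Q × G) where
  baseSet : Set (Base G Q)
  open_baseSet : IsOpen baseSet
  source_eq : source = proj G ⁻¹' baseSet
  target_eq : target = baseSet ×ˢ Set.univ
  fst_eq : ∀ q ∈ source, (toFun q).1 = proj G q
  equivariant : ∀ (g : G), ∀ q ∈ source, (toFun (g • q)).2 = g * (toFun q).2
  contMDiffOn_toFun : ContMDiffOn 𝓘(ℝ, EQ) (𝓘(ℝ, EB).prod 𝓘(ℝ, EG)) ∞ toFun source
  contMDiffOn_invFun : ContMDiffOn (𝓘(ℝ, EB).prod 𝓘(ℝ, EG)) 𝓘(ℝ, EQ) ∞ invFun target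

/-- `π : Q → Q / G` is a smooth principal bundle with structure group `G`. -/
structure IsPrincipalBundle : Prop where
  exists_localTriv : ∀ b : Base G Q, ∃ e : LocalTriv EQ EB EG G Q, b ∈ e.baseSet

end Bundle

variable {EQ EB EG G Q : Type*}
  [NormedAddCommGroup EQ] [NormedSpace ℝ EQ]
  [NormedAddCommGroup EB] [NormedSpace ℝ EB]
  [NormedAddCommGroup EG] [NormedSpace ℝ EG]
  [TopologicalSpace Q] [ChartedSpace EQ Q]
  [Group G] [TopologicalSpace G] [ChartedSpace EG G]
  [MulAction G Q] [ChartedSpace EB (Base G Q)]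

theorem proj_smul (g : G) (q : Q) : proj G (g • q) = proj G q :=
  Quotient.sound ⟨g, rfl⟩

theorem proj_eq_iff {q q' : Q} : proj G q = proj G q' ↔ ∃ g : G, g • q' = q :=
  Quotient.eq.trans Iff.rfl

theorem continuous_proj : Continuous (proj G : Q → Base G Q) := continuous_quotient_mk'

namespace LocalTriv

variable (e : LocalTriv EQ EB EG G Q)

theorem mem_source {q : Q} : q ∈ e.source ↔ proj G q ∈ e.baseSet := by
  rw [e.source_eq]; rfl

theorem coe_fst {q : Q} (h : proj G q ∈ e.baseSet) :
    (e.toOpenPartialHomeomorph q).1 = proj G q :=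
  e.fst_eq q (e.mem_source.2 h)

theorem coe_smul_snd (g : G) {q : Q} (h : proj G q ∈ e.baseSet) :
    (e.toOpenPartialHomeomorph (g • q)).2 = g * (e.toOpenPartialHomeomorph q).2 :=
  e.equivariant g q (e.mem_source.2 h)

theorem mem_target {y : Base G Q × G} : y ∈ e.target ↔ y.1 ∈ e.baseSet := by
  rw [e.target_eq]; simp

theorem proj_symm {y : Base G Q × G} (h : y.1 ∈ e.baseSet) :
    proj G (e.toOpenPartialHomeomorph.symm y) = y.1 := by
  have h1 := e.toOpenPartialHomeomorph.map_target (e.mem_target.2 h)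
  rw [← e.coe_fst (e.mem_source.1 h1), e.toOpenPartialHomeomorph.right_inv (e.mem_target.2 h)]

theorem coe_symm {y : Base G Q × G} (h : y.1 ∈ e.baseSet) :
    e.toOpenPartialHomeomorph (e.toOpenPartialHomeomorph.symm y) = y :=
  e.toOpenPartialHomeomorph.right_inv (e.mem_target.2 h)

theorem symm_one {q : Q} (h : proj G q ∈ e.baseSet) :
    e.toOpenPartialHomeomorph.symm (proj G q, 1) =
      (e.toOpenPartialHomeomorph q).2⁻¹ • q := by
  have h' : proj G ((e.toOpenPartialHomeomorph q).2⁻¹ • q) ∈ e.baseSet := by rwa [proj_smul]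
  have : e.toOpenPartialHomeomorph ((e.toOpenPartialHomeomorph q).2⁻¹ • q) = (proj G q, 1) := by
    refine Prod.ext ?_ ?_
    · rw [e.coe_fst h', proj_smul]
    · rw [e.coe_smul_snd _ h]; simp
  rw [← this, e.toOpenPartialHomeomorph.left_inv (e.mem_source.2 h')]

end LocalTriv

/-! ### The conjugate bundle `(Q × G) / G` -/

variable (G Q) in
/-- The orbit equivalence relation of the action `g · (q, w) = (g q, g w g⁻¹)` on `Q × G`. -/
def conjSetoid : Setoid (Q × G) where
  r x y := ∃ g : G, (g • y.1, g * y.2 * g⁻¹) = x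
  iseqv :=
    { refl := fun x => ⟨1, by simp⟩
      symm := by
        rintro x y ⟨g, rfl⟩
        exact ⟨g⁻¹, Prod.ext (by simp) (by simp [mul_assoc])⟩
      trans := by
        rintro x y z ⟨g, rfl⟩ ⟨h, rfl⟩
        exact ⟨g * h, Prod.ext (by simp [mul_smul]) (by simp [mul_assoc])⟩ }

/-- The conjugate bundle `(Q × G) / G` associated to the principal bundle `π : Q → Q / G`.
(The type depends on the principal bundle only for the sake of its manifold structure, below.) -/
def ConjBundle (_P : IsPrincipalBundle EQ EB EG G Q) : Type _ := Quotient (conjSetoid G Q)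

namespace ConjBundle

variable (P : IsPrincipalBundle EQ EB EG G Q)

/-- The quotient topology. -/
instance : TopologicalSpace (ConjBundle P) :=
  inferInstanceAs (TopologicalSpace (Quotient (conjSetoid G Q)))

/-- The quotient map `ρ : Q × G → (Q × G) / G`. -/
def rho (x : Q × G) : ConjBundle P := Quotient.mk (conjSetoid G Q) x

theorem rho_smul (g : G) (q : Q) (w : G) : rho P (g • q, g * w * g⁻¹) = rho P (q, w) :=
  Quotient.sound ⟨g, rfl⟩

theorem rho_surjective : Function.Surjective (rho P) := Quotient.mk_surjective

theorem continuous_rho : Continuous (rho P) := continuous_quotient_mk'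

/-- The bundle projection `(Q × G) / G → Q / G` induced by the first projection. -/
def pr (v : ConjBundle P) : Base G Q :=
  Quotient.lift (fun x : Q × G => proj G x.1)
    (by rintro x y ⟨g, rfl⟩; exact proj_smul g y.1) v

theorem continuous_pr : Continuous (pr P) :=
  Continuous.quotient_lift (continuous_proj.comp continuous_fst) _

open Classical in
/-- In a local trivialization `q ↦ (π q, χ q)` of `π`, the map
`[q, w] ↦ (π q, χ(q)⁻¹ w χ(q))`. -/
def trivFun (e : LocalTriv EQ EB EG G Q) (v : ConjBundle P) : Base G Q × G :=
  Quotient.lift (fun x : Q × G => (proj G x.1,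
      if proj G x.1 ∈ e.baseSet then
        (e.toOpenPartialHomeomorph x.1).2⁻¹ * x.2 * (e.toOpenPartialHomeomorph x.1).2
      else 1))
    (by
      rintro x y ⟨g, rfl⟩
      simp only [proj_smul]
      by_cases h : proj G y.1 ∈ e.baseSet
      · simp [h, e.coe_smul_snd g h, mul_assoc]
      · simp [h]) v

theorem trivFun_rho (e : LocalTriv EQ EB EG G Q) {q : Q} (h : proj G q ∈ e.baseSet) (w : G) :
    trivFun P e (rho P (q, w)) = (proj G q,
      (e.toOpenPartialHomeomorph q).2⁻¹ * w * (e.toOpenPartialHomeomorph q).2) := by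
  classical
  simp only [trivFun, rho, Quotient.lift_mk]
  rw [if_pos h]

variable [LieGroup 𝓘(ℝ, EG) ∞ G]

/-- The local trivialization `[q, w] ↦ (π q, χ(q)⁻¹ w χ(q))` of `(Q × G) / G` induced by the local
trivialization `q ↦ (π q, χ q)` of `π`. -/
def triv (e : LocalTriv EQ EB EG G Q) :
    OpenPartialHomeomorph (ConjBundle P) (Base G Q × G) where
  toFun := trivFun P e
  invFun y := rho P (e.toOpenPartialHomeomorph.symm (y.1, 1), y.2)
  source := pr P ⁻¹' e.baseSet
  target := e.baseSet ×ˢ Set.univ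
  map_source' := by
    intro v hv
    obtain ⟨⟨q, w⟩, rfl⟩ := rho_surjective P v
    exact ⟨hv, trivial⟩
  map_target' := by
    rintro ⟨b, w⟩ ⟨hb, -⟩
    show proj G (e.toOpenPartialHomeomorph.symm (b, 1)) ∈ e.baseSet
    rw [e.proj_symm (y := (b, 1)) hb]
    exact hb
  left_inv' := by
    intro v hv
    obtain ⟨⟨q, w⟩, rfl⟩ := rho_surjective P v
    have hq : proj G q ∈ e.baseSet := hv
    rw [trivFun_rho P e hq]
    simp only
    rw [e.symm_one hq]
    conv_rhs => rw [← rho_smul P (e.toOpenPartialHomeomorph q).2⁻¹ q w]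
    simp
  right_inv' := by
    rintro ⟨b, w⟩ ⟨hb, -⟩
    have hb' : b ∈ e.baseSet := hb
    have h1 := e.proj_symm (y := (b, (1 : G))) hb
    have h2 := e.coe_symm (y := (b, (1 : G))) hb
    rw [trivFun_rho P e (by rw [h1]; exact hb), h1, h2]
    simp
  open_source := e.open_baseSet.preimage (continuous_pr P)
  open_target := e.open_baseSet.prod isOpen_univ
  continuousOn_toFun := by
    have : IsTopologicalGroup G := topologicalGroup_of_lieGroup 𝓘(ℝ, EG) ∞
    have hq : Topology.IsQuotientMap (rho P) := isQuotientMap_quotient_mk'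
    rw [hq.continuousOn_isOpen_iff (e.open_baseSet.preimage (continuous_pr P))]
    have hmaps : Set.MapsTo (Prod.fst : Q × G → Q)
        (rho P ⁻¹' (pr P ⁻¹' e.baseSet)) e.source := fun x hx => e.mem_source.2 hx
    have hc : ContinuousOn (fun x : Q × G => (e.toOpenPartialHomeomorph x.1).2)
        (rho P ⁻¹' (pr P ⁻¹' e.baseSet)) :=
      continuous_snd.comp_continuousOn
        (e.toOpenPartialHomeomorph.continuousOn.comp continuous_fst.continuousOn hmaps)
    refine ContinuousOn.congr (f := fun x : Q × G => (proj G x.1,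
      (e.toOpenPartialHomeomorph x.1).2⁻¹ * x.2 * (e.toOpenPartialHomeomorph x.1).2)) ?_ ?_
    · exact (continuous_proj.comp continuous_fst).continuousOn.prodMk
        ((hc.inv.mul continuous_snd.continuousOn).mul hc)
    · rintro ⟨q, w⟩ hx
      exact trivFun_rho P e hx w
  continuousOn_invFun := by
    refine (continuous_rho P).comp_continuousOn (ContinuousOn.prodMk ?_ continuous_snd.continuousOn)
    refine e.toOpenPartialHomeomorph.symm.continuousOn.comp
      (continuous_fst.prodMk continuous_const).continuousOn ?_
    rintro ⟨b, w⟩ ⟨hb, -⟩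
    exact e.mem_target.2 hb

/-- The local trivializations of `(Q × G) / G` by open subsets of `Q / G × G`. -/
instance : ChartedSpace (Base G Q × G) (ConjBundle P) where
  atlas := {t | ∃ e : LocalTriv EQ EB EG G Q, t = triv P e}
  chartAt v := triv P (P.exists_localTriv (pr P v)).choose
  mem_chart_source v := (P.exists_localTriv (pr P v)).choose_spec
  chart_mem_atlas v := ⟨_, rfl⟩

/-- The manifold structure of `(Q × G) / G`: its charts are the local trivializations induced by
those of `π`, followed by charts of `Q / G × G`. -/
instance : ChartedSpace (ModelProd EB EG) (ConjBundle P) :=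
  ChartedSpace.comp (ModelProd EB EG) (Base G Q × G) (ConjBundle P)

/-- The transition maps `(b, w) ↦ (b, a(b)⁻¹ w a(b))` of the conjugate bundle are smooth. -/
theorem contMDiffOn_triv_symm_trans (e e' : LocalTriv EQ EB EG G Q) :
    ContMDiffOn (𝓘(ℝ, EB).prod 𝓘(ℝ, EG)) (𝓘(ℝ, EB).prod 𝓘(ℝ, EG)) ∞
      ((triv P e).symm.trans (triv P e')) ((triv P e).symm.trans (triv P e')).source := by
  have hsrc : ∀ y ∈ ((triv P e).symm.trans (triv P e')).source,
      y.1 ∈ e.baseSet ∧ y.1 ∈ e'.baseSet := by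
    rintro ⟨b, w⟩ ⟨⟨hb, -⟩, hb'⟩
    refine ⟨hb, ?_⟩
    have h : proj G (e.toOpenPartialHomeomorph.symm (b, 1)) ∈ e'.baseSet := hb'
    rwa [e.proj_symm (y := (b, (1 : G))) hb] at h
  have h1 : ContMDiffOn (𝓘(ℝ, EB).prod 𝓘(ℝ, EG)) 𝓘(ℝ, EQ) ∞
      (fun y : Base G Q × G => e.toOpenPartialHomeomorph.symm (y.1, 1))
      ((triv P e).symm.trans (triv P e')).source :=
    e.contMDiffOn_invFun.comp
      (contMDiff_fst.prodMk contMDiff_const).contMDiffOn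
      (fun y hy => e.mem_target.2 (hsrc y hy).1)
  have h2 : ContMDiffOn (𝓘(ℝ, EB).prod 𝓘(ℝ, EG)) 𝓘(ℝ, EG) ∞
      (fun y : Base G Q × G =>
        (e'.toOpenPartialHomeomorph (e.toOpenPartialHomeomorph.symm (y.1, 1))).2)
      ((triv P e).symm.trans (triv P e')).source := by
    refine contMDiff_snd.comp_contMDiffOn (e'.contMDiffOn_toFun.comp h1 ?_)
    intro y hy
    refine e'.mem_source.2 ?_
    rw [e.proj_symm (y := (y.1, (1 : G))) (hsrc y hy).1]
    exact (hsrc y hy).2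
  refine ContMDiffOn.congr
    (contMDiff_fst.contMDiffOn.prodMk ((h2.inv.mul contMDiff_snd.contMDiffOn).mul h2)) ?_
  intro y hy
  have h3 := e.proj_symm (y := (y.1, (1 : G))) (hsrc y hy).1
  have h4 := trivFun_rho P e' (q := e.toOpenPartialHomeomorph.symm (y.1, 1))
    (by rw [h3]; exact (hsrc y hy).2) y.2
  rw [h3] at h4
  exact h4

/-- The conjugate bundle is a smooth manifold. -/
instance [IsManifold 𝓘(ℝ, EB) ∞ (Base G Q)] :
    IsManifold (𝓘(ℝ, EB).prod 𝓘(ℝ, EG)) ∞ (ConjBundle P) := by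
  have : IsManifold 𝓘(ℝ, EG) ∞ G := LieGroup.toContMDiffMul.toIsManifold
  refine isManifold_of_contDiffOn _ _ _ ?_
  rintro _ _ ⟨_, ⟨e, rfl⟩, c, hc, rfl⟩ ⟨_, ⟨e', rfl⟩, c', hc', rfl⟩
  rw [← contMDiffOn_iff_contDiffOn]
  have k1 := contMDiffOn_symm_of_mem_maximalAtlas (I := 𝓘(ℝ, EB).prod 𝓘(ℝ, EG)) (n := ∞)
    (StructureGroupoid.subset_maximalAtlas _ hc)
  have k2 := contMDiffOn_of_mem_maximalAtlas (I := 𝓘(ℝ, EB).prod 𝓘(ℝ, EG)) (n := ∞)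
    (StructureGroupoid.subset_maximalAtlas _ hc')
  have k3 := contMDiffOn_triv_symm_trans P e e'
  have k4 := (𝓘(ℝ, EB).prod 𝓘(ℝ, EG)).contMDiffOn_symm (n := ∞)
  refine (𝓘(ℝ, EB).prod 𝓘(ℝ, EG)).contMDiff.comp_contMDiffOn
    (k2.comp (k3.comp (k1.comp (k4.mono ?_) ?_) ?_) ?_)
  · exact Set.inter_subset_right
  · rintro x ⟨hx, -⟩
    exact hx.1.1
  · rintro x ⟨hx, -⟩
    exact ⟨hx.1.2, hx.2.1⟩
  · rintro x ⟨hx, -⟩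
    exact hx.2.2

end ConjBundle

/-! ### Infinitesimal generators, adjoint action, connections -/

variable (EG) in
/-- The infinitesimal generator `ξ ↦ ξ_Q(q)` of the action of `G` on `Q`: the derivative at the
identity of the orbit map `g ↦ g • q`, that is, the velocity at `t = 0` of `c(t) • q` for any curve
`c` in `G` with `c(0) = 1` and `c'(0) = ξ`. -/
def generator (q : Q) : GroupLieAlgebra 𝓘(ℝ, EG) G →L[ℝ] TangentSpace 𝓘(ℝ, EQ) q :=
  (mfderiv 𝓘(ℝ, EG) 𝓘(ℝ, EQ) (fun g : G => g • q) 1 : EG →L[ℝ] EQ)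

variable (EG) in
/-- The adjoint action of `G` on its Lie algebra: `Ad g` is the derivative at the identity of
`x ↦ g x g⁻¹`. -/
def Ad (g : G) : GroupLieAlgebra 𝓘(ℝ, EG) G →L[ℝ] GroupLieAlgebra 𝓘(ℝ, EG) G :=
  (mfderiv 𝓘(ℝ, EG) 𝓘(ℝ, EG) (fun x : G => g * x * g⁻¹) 1 : EG →L[ℝ] EG)

/-- The differential `T_q l_g : T_q M → T_{g q} M` of the action of `g` on a manifold `M`. -/
def tangentAction {E H M : Type*} [NormedAddCommGroup E] [NormedSpace ℝ E] [TopologicalSpace H]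
    (I : ModelWithCorners ℝ E H) [TopologicalSpace M] [ChartedSpace H M] [MulAction G M]
    (g : G) (q : M) : TangentSpace I q →L[ℝ] TangentSpace I (g • q) :=
  mfderiv I I (fun x : M => g • x) q

variable (EQ EB EG G Q) in
/-- A principal connection on `π : Q → Q / G`, as a smooth Lie-algebra-valued `1`-form. -/
structure PrincipalConnection [IsManifold 𝓘(ℝ, EQ) ∞ Q] where
  form : ∀ q : Q, TangentSpace 𝓘(ℝ, EQ) q →L[ℝ] GroupLieAlgebra 𝓘(ℝ, EG) G
  contMDiff_form : ContMDiff 𝓘(ℝ, EQ) (𝓘(ℝ, EQ).prod 𝓘(ℝ, EQ →L[ℝ] EG)) ∞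
    (fun q => Bundle.TotalSpace.mk' (EQ →L[ℝ] EG)
      (E := fun q : Q => TangentSpace 𝓘(ℝ, EQ) q →L[ℝ] Bundle.Trivial Q EG q) q (form q))
  form_generator : ∀ (q : Q) (ξ : GroupLieAlgebra 𝓘(ℝ, EG) G), form q (generator EG q ξ) = ξ
  form_smul : ∀ (g : G) (q : Q) (v : TangentSpace 𝓘(ℝ, EQ) q),
    form (g • q) (tangentAction 𝓘(ℝ, EQ) g q v) = Ad EG g (form q v)

variable (EQ EB EG G Q) in
/-- An affine discrete connection on `π : Q → Q / G` with level function `level`, defined on all of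
`Q × Q`: an embedded submanifold `Hor` of `Q × Q` that contains the graph of `q ↦ level(q) • q` and
is invariant under the diagonal action, such that `id × π` restricts to an injective local
diffeomorphism `Hor → Q × Q / G`, and whose domain `{(q₀, g q₁) | (q₀, q₁) ∈ Hor, g ∈ G}` is
`Q × Q`. -/
structure AffineDiscreteConnection where
  level : Q → G
  contMDiff_level : ContMDiff 𝓘(ℝ, EQ) 𝓘(ℝ, EG) ∞ level
  level_smul : ∀ (g : G) (q : Q), level (g • q) = g * level q * g⁻¹
  Hor : Set (Q × Q)
  [chartedSpace : ChartedSpace (ModelProd EQ EB) Hor]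
  [isManifold : IsManifold (𝓘(ℝ, EQ).prod 𝓘(ℝ, EB)) ∞ Hor]
  isSmoothEmbedding : Manifold.IsSmoothEmbedding (𝓘(ℝ, EQ).prod 𝓘(ℝ, EB))
    (𝓘(ℝ, EQ).prod 𝓘(ℝ, EQ)) ∞ (Subtype.val : Hor → Q × Q)
  level_mem : ∀ q : Q, (q, level q • q) ∈ Hor
  smul_mem : ∀ (g : G) (p : Q × Q), p ∈ Hor → g • p ∈ Hor
  injective : Function.Injective (fun p : Hor => (p.1.1, proj G p.1.2))
  isLocalDiffeomorph : IsLocalDiffeomorph (𝓘(ℝ, EQ).prod 𝓘(ℝ, EB)) (𝓘(ℝ, EQ).prod 𝓘(ℝ, EB)) ∞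
    (fun p : Hor => (p.1.1, proj G p.1.2))
  domain : ∀ q₀ q₁ : Q, ∃ g : G, (q₀, g⁻¹ • q₁) ∈ Hor

namespace AffineDiscreteConnection

variable (A : AffineDiscreteConnection EQ EB EG G Q)

/-- The discrete connection form `𝒜_d : Q × Q → G`: the element `g` with `(q₀, g⁻¹ q₁) ∈ Hor`
(unique, as the action is free). -/
def form (p : Q × Q) : G := (A.domain p.1 p.2).choose

theorem form_spec (p : Q × Q) : (p.1, (A.form p)⁻¹ • p.2) ∈ A.Hor :=
  (A.domain p.1 p.2).choose_spec

theorem snd_eq {q q₁ q₁' : Q} (h : (q, q₁) ∈ A.Hor) (h' : (q, q₁') ∈ A.Hor)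
    (hp : proj G q₁ = proj G q₁') : q₁ = q₁' := by
  have := A.injective (a₁ := ⟨_, h⟩) (a₂ := ⟨_, h'⟩) (by simp [hp])
  simpa using this

theorem exists_lift (q : Q) (τ : Base G Q) : ∃ q₁ : Q, (q, q₁) ∈ A.Hor ∧ proj G q₁ = τ := by
  obtain ⟨q₁, rfl⟩ := Quotient.mk_surjective τ
  obtain ⟨g, hg⟩ := A.domain q q₁
  exact ⟨_, hg, proj_smul _ _⟩

/-- The second component of the discrete horizontal lift: the `q₁` with `(q, q₁) ∈ Hor` and
`π(q₁) = τ`. -/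
def lift (q : Q) (τ : Base G Q) : Q := (A.exists_lift q τ).choose

theorem lift_mem (q : Q) (τ : Base G Q) : (q, A.lift q τ) ∈ A.Hor :=
  (A.exists_lift q τ).choose_spec.1

theorem proj_lift (q : Q) (τ : Base G Q) : proj G (A.lift q τ) = τ :=
  (A.exists_lift q τ).choose_spec.2

theorem lift_smul (g : G) (q : Q) (τ : Base G Q) : A.lift (g • q) τ = g • A.lift q τ := by
  refine A.snd_eq (A.lift_mem _ _) (A.smul_mem g _ (A.lift_mem q τ)) ?_
  rw [proj_smul, proj_lift, proj_lift]

end AffineDiscreteConnection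

theorem IsPrincipalBundle.smul_inj (P : IsPrincipalBundle EQ EB EG G Q) {g h : G} {q : Q}
    (hq : g • q = h • q) : g = h := by
  obtain ⟨e, he⟩ := P.exists_localTriv (proj G q)
  have := e.coe_smul_snd g he
  rw [hq, e.coe_smul_snd h he] at this
  exact (mul_right_cancel this).symm

theorem AffineDiscreteConnection.form_smul (A : AffineDiscreteConnection EQ EB EG G Q)
    (P : IsPrincipalBundle EQ EB EG G Q) (g : G) (p : Q × Q) :
    A.form (g • p) = g * A.form p * g⁻¹ := by
  have h1 := A.form_spec (g • p)
  have h2 := A.smul_mem g _ (A.form_spec p)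
  have h3 := A.snd_eq h1 h2 (by
    simp only [proj_smul, Prod.smul_snd])
  have h4 : (A.form (g • p))⁻¹ * g = g * (A.form p)⁻¹ := by
    refine P.smul_inj (q := p.2) ?_
    simpa [mul_smul] using h3
  have h5 : (A.form (g • p))⁻¹ = g * (A.form p)⁻¹ * g⁻¹ := by rw [← h4]; simp
  rw [← inv_inv (A.form (g • p)), h5]
  simp [mul_assoc]

theorem Ad_one [LieGroup 𝓘(ℝ, EG) ∞ G] (ξ : GroupLieAlgebra 𝓘(ℝ, EG) G) :
    Ad EG (1 : G) ξ = ξ := by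
  have h : ∀ f : G → G, f = id → (mfderiv 𝓘(ℝ, EG) 𝓘(ℝ, EG) f 1 : EG →L[ℝ] EG) =
      ContinuousLinearMap.id ℝ EG := by
    rintro _ rfl
    exact mfderiv_id
  exact DFunLike.congr_fun (h (fun x : G => 1 * x * 1⁻¹) (by ext; simp)) ξ

theorem Ad_mul [LieGroup 𝓘(ℝ, EG) ∞ G] (g h : G) (ξ : GroupLieAlgebra 𝓘(ℝ, EG) G) :
    Ad EG (g * h) ξ = Ad EG g (Ad EG h ξ) := by
  have hsm : ∀ k : G, MDifferentiable 𝓘(ℝ, EG) 𝓘(ℝ, EG) (fun x : G => k * x * k⁻¹) := fun k =>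
    ((contMDiff_const.mul contMDiff_id).mul contMDiff_const : ContMDiff 𝓘(ℝ, EG) 𝓘(ℝ, EG) ∞
      (fun x : G => k * x * k⁻¹)).mdifferentiable (by simp)
  have e1 : (fun x : G => g * h * x * (g * h)⁻¹) =
      (fun x : G => g * x * g⁻¹) ∘ (fun x : G => h * x * h⁻¹) := by
    ext x; simp [mul_assoc]
  have e2 := mfderiv_comp (1 : G) (hsm g (h * 1 * h⁻¹)) (hsm h 1)
  rw [← e1] at e2
  have e3 : h * 1 * h⁻¹ = 1 := by simp
  have e4 : ∀ y : G, y = 1 → (mfderiv 𝓘(ℝ, EG) 𝓘(ℝ, EG) (fun x : G => g * x * g⁻¹) y : EG →L[ℝ] EG)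
      = mfderiv 𝓘(ℝ, EG) 𝓘(ℝ, EG) (fun x : G => g * x * g⁻¹) 1 := by rintro _ rfl; rfl
  have e5 := e4 _ e3
  have e6 := DFunLike.congr_fun e2 ξ
  refine e6.trans ?_
  exact DFunLike.congr_fun e5 _

/-! ### Horizontal lift -/

theorem IsPrincipalBundle.contMDiff_proj (P : IsPrincipalBundle EQ EB EG G Q) :
    ContMDiff 𝓘(ℝ, EQ) 𝓘(ℝ, EB) ∞ (proj G : Q → Base G Q) := by
  intro q
  obtain ⟨e, he⟩ := P.exists_localTriv (proj G q)
  have h1 : ContMDiffAt 𝓘(ℝ, EQ) (𝓘(ℝ, EB).prod 𝓘(ℝ, EG)) ∞ e.toFun q :=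
    e.contMDiffOn_toFun.contMDiffAt (e.open_source.mem_nhds (e.mem_source.2 he))
  refine (contMDiff_fst.contMDiffAt.comp q h1).congr_of_eventuallyEq ?_
  filter_upwards [e.open_source.mem_nhds (e.mem_source.2 he)] with x hx
  exact (e.fst_eq x hx).symm

theorem exists_mfderiv_section (P : IsPrincipalBundle EQ EB EG G Q) (q : Q) :
    ∃ σ : EB →L[ℝ] EQ,
      (mfderiv 𝓘(ℝ, EQ) 𝓘(ℝ, EB) (proj G) q : EQ →L[ℝ] EB).comp σ = ContinuousLinearMap.id ℝ EB := by
  obtain ⟨e, he⟩ := P.exists_localTriv (proj G q)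
  let c := (e.toOpenPartialHomeomorph q).2
  let s : Base G Q → Q := fun b => e.toOpenPartialHomeomorph.symm (b, c)
  have hs : s (proj G q) = q := by
    have : ((proj G q, c) : Base G Q × G) = e.toOpenPartialHomeomorph q :=
      Prod.ext (e.coe_fst he).symm rfl
    simp only [s, this]
    exact e.toOpenPartialHomeomorph.left_inv (e.mem_source.2 he)
  have hopen : e.baseSet ∈ 𝓝 (proj G q) := e.open_baseSet.mem_nhds he
  have hsm : MDifferentiableAt 𝓘(ℝ, EB) 𝓘(ℝ, EQ) s (proj G q) := by
    have h1 : ContMDiffOn 𝓘(ℝ, EB) 𝓘(ℝ, EQ) ∞ s e.baseSet :=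
      e.contMDiffOn_invFun.comp (contMDiff_id.prodMk contMDiff_const).contMDiffOn
        (fun b hb => e.mem_target.2 hb)
    exact (h1.contMDiffAt hopen).mdifferentiableAt (by simp)
  have hp : MDifferentiableAt 𝓘(ℝ, EQ) 𝓘(ℝ, EB) (proj G : Q → Base G Q) (s (proj G q)) :=
    (P.contMDiff_proj _).mdifferentiableAt (by simp)
  have hcomp : mfderiv 𝓘(ℝ, EB) 𝓘(ℝ, EB) (proj G ∘ s) (proj G q) =
      mfderiv 𝓘(ℝ, EB) 𝓘(ℝ, EB) id (proj G q) := by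
    refine Filter.EventuallyEq.mfderiv_eq ?_
    filter_upwards [hopen] with b hb
    exact e.proj_symm (y := (b, c)) hb
  rw [mfderiv_comp _ hp hsm, mfderiv_id] at hcomp
  refine ⟨mfderiv 𝓘(ℝ, EB) 𝓘(ℝ, EQ) s (proj G q), ?_⟩
  have key : ∀ q' : Q, q' = q → (mfderiv 𝓘(ℝ, EQ) 𝓘(ℝ, EB) (proj G) q' : EQ →L[ℝ] EB) =
      (mfderiv 𝓘(ℝ, EQ) 𝓘(ℝ, EB) (proj G) q : EQ →L[ℝ] EB) := by rintro _ rfl; rfl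
  rw [← key _ hs]
  exact hcomp

theorem mfderiv_proj_generator (P : IsPrincipalBundle EQ EB EG G Q)
    [LieGroup 𝓘(ℝ, EG) ∞ G] [IsManifold 𝓘(ℝ, EQ) ∞ Q] [ContMDiffSMul 𝓘(ℝ, EG) 𝓘(ℝ, EQ) ∞ G Q]
    (q : Q) :
    (mfderiv 𝓘(ℝ, EQ) 𝓘(ℝ, EB) (proj G) q : EQ →L[ℝ] EB).comp
      (generator (G := G) EG q : EG →L[ℝ] EQ) = 0 := by
  have ho : MDifferentiableAt 𝓘(ℝ, EG) 𝓘(ℝ, EQ) (fun g : G => g • q) 1 :=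
    ((contMDiff_id.smul contMDiff_const : ContMDiff 𝓘(ℝ, EG) 𝓘(ℝ, EQ) ∞
      ((id : G → G) • (fun _ : G => q))) 1).mdifferentiableAt (by simp)
  have hp : MDifferentiableAt 𝓘(ℝ, EQ) 𝓘(ℝ, EB) (proj G : Q → Base G Q) ((1 : G) • q) :=
    (P.contMDiff_proj _).mdifferentiableAt (by simp)
  have hcomp : mfderiv 𝓘(ℝ, EG) 𝓘(ℝ, EB) (proj G ∘ (fun g : G => g • q)) 1 = 0 := by
    have : (proj G ∘ (fun g : G => g • q)) = fun _ => proj G q := by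
      ext g; exact proj_smul g q
    rw [this]
    exact mfderiv_const
  rw [mfderiv_comp (1 : G) (f := fun g : G => g • q) (g := proj G) hp ho] at hcomp
  have key : ∀ q' : Q, q' = q → (mfderiv 𝓘(ℝ, EQ) 𝓘(ℝ, EB) (proj G) q' : EQ →L[ℝ] EB) =
      (mfderiv 𝓘(ℝ, EQ) 𝓘(ℝ, EB) (proj G) q : EQ →L[ℝ] EB) := by rintro _ rfl; rfl
  rw [← key _ (one_smul G q)]
  exact hcomp

theorem exists_horizontalLift (P : IsPrincipalBundle EQ EB EG G Q)
    [LieGroup 𝓘(ℝ, EG) ∞ G] [IsManifold 𝓘(ℝ, EQ) ∞ Q] [ContMDiffSMul 𝓘(ℝ, EG) 𝓘(ℝ, EQ) ∞ G Q]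
    (C : PrincipalConnection EQ EG G Q) (q : Q) :
    ∃ h : TangentSpace 𝓘(ℝ, EB) (proj G q) →L[ℝ] TangentSpace 𝓘(ℝ, EQ) q,
      ∀ w, C.form q (h w) = 0 ∧ mfderiv 𝓘(ℝ, EQ) 𝓘(ℝ, EB) (proj G) q (h w) = w := by
  obtain ⟨σ, hσ⟩ := exists_mfderiv_section P q
  have hgen := mfderiv_proj_generator (EG := EG) (G := G) P q
  have hC := C.form_generator q
  let D : EQ →L[ℝ] EB := mfderiv 𝓘(ℝ, EQ) 𝓘(ℝ, EB) (proj G) q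
  let v : EG →L[ℝ] EQ := generator (G := G) EG q
  let a : EQ →L[ℝ] EG := C.form q
  have h1 : ∀ w, D (σ w) = w := fun w => DFunLike.congr_fun hσ w
  have h2 : ∀ ξ, D (v ξ) = 0 := fun ξ => DFunLike.congr_fun hgen ξ
  have h3 : ∀ ξ, a (v ξ) = ξ := hC
  have h4 : ∃ h : EB →L[ℝ] EQ, ∀ w, a (h w) = 0 ∧ D (h w) = w :=
    ⟨σ - v.comp (a.comp σ), fun w => by simp [h1, h2, h3]⟩
  exact h4

section System

variable (P : IsPrincipalBundle EQ EB EG G Q)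
  [LieGroup 𝓘(ℝ, EG) ∞ G] [IsManifold 𝓘(ℝ, EQ) ∞ Q] [ContMDiffSMul 𝓘(ℝ, EG) 𝓘(ℝ, EQ) ∞ G Q]
  (C : PrincipalConnection EQ EG G Q) (A : AffineDiscreteConnection EQ EB EG G Q)

/-- The horizontal lift `h^q : T_{π(q)}(Q / G) → T_q Q` of a principal connection: `h^q(w)` is the
(unique) horizontal `v` with `T_q π (v) = w`. -/
def horizontalLift (q : Q) : TangentSpace 𝓘(ℝ, EB) (proj G q) →L[ℝ] TangentSpace 𝓘(ℝ, EQ) q :=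
  (exists_horizontalLift P C q).choose

/-! ### Forced discrete mechanical systems -/

variable (EQ Q) in
/-- A forced discrete mechanical system on `Q`: a smooth discrete Lagrangian `L` on `Q × Q` and a
smooth `1`-form `f` on `Q × Q`, the discrete force. -/
structure ForcedDMS where
  L : Q × Q → ℝ
  contMDiff_L : ContMDiff (𝓘(ℝ, EQ).prod 𝓘(ℝ, EQ)) 𝓘(ℝ, ℝ) ∞ L
  f : ∀ p : Q × Q, TangentSpace (𝓘(ℝ, EQ).prod 𝓘(ℝ, EQ)) p →L[ℝ] ℝ
  contMDiff_f : ContMDiff (𝓘(ℝ, EQ).prod 𝓘(ℝ, EQ))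
    ((𝓘(ℝ, EQ).prod 𝓘(ℝ, EQ)).prod 𝓘(ℝ, EQ × EQ →L[ℝ] ℝ)) ∞
    (fun p => Bundle.TotalSpace.mk' (EQ × EQ →L[ℝ] ℝ)
      (E := fun p : Q × Q => TangentSpace (𝓘(ℝ, EQ).prod 𝓘(ℝ, EQ)) p →L[ℝ]
        Bundle.Trivial (Q × Q) ℝ p) p (f p))

variable (S : ForcedDMS EQ Q)

variable (G) in
/-- `G` is a symmetry group of the system: `L` is invariant and the section `f` of `T*(Q × Q)` is
equivariant for the diagonal action and its cotangent lift, i.e. invariant as a `1`-form. -/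
structure ForcedDMS.IsSymmetric : Prop where
  L_smul : ∀ (g : G) (p : Q × Q), S.L (g • p) = S.L p
  f_smul : ∀ (g : G) (p : Q × Q) (v : TangentSpace (𝓘(ℝ, EQ).prod 𝓘(ℝ, EQ)) p),
    S.f (g • p) (tangentAction (𝓘(ℝ, EQ).prod 𝓘(ℝ, EQ)) g p v) = S.f p v

/-- The differential `dF(x) ∈ T*_x M` of a function `F : M → ℝ`. -/
def differential {E H M : Type*} [NormedAddCommGroup E] [NormedSpace ℝ E] [TopologicalSpace H]
    (I : ModelWithCorners ℝ E H) [TopologicalSpace M] [ChartedSpace H M]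
    (F : M → ℝ) (x : M) : TangentSpace I x →L[ℝ] ℝ :=
  mfderiv I 𝓘(ℝ, ℝ) F x

/-- The inclusion `δx ↦ (δx, 0)`, `T_x M → T_{(x, y)}(M × N)`. -/
def tangentInl {E E' H H' M M' : Type*} [NormedAddCommGroup E] [NormedSpace ℝ E]
    [NormedAddCommGroup E'] [NormedSpace ℝ E'] [TopologicalSpace H] [TopologicalSpace H']
    (I : ModelWithCorners ℝ E H) (I' : ModelWithCorners ℝ E' H')
    [TopologicalSpace M] [ChartedSpace H M] [TopologicalSpace M'] [ChartedSpace H' M']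
    (x : M) (y : M') : TangentSpace I x →L[ℝ] TangentSpace (I.prod I') (x, y) :=
  ContinuousLinearMap.inl ℝ E E'

/-- The inclusion `δy ↦ (0, δy)`, `T_y N → T_{(x, y)}(M × N)`. -/
def tangentInr {E E' H H' M M' : Type*} [NormedAddCommGroup E] [NormedSpace ℝ E]
    [NormedAddCommGroup E'] [NormedSpace ℝ E'] [TopologicalSpace H] [TopologicalSpace H']
    (I : ModelWithCorners ℝ E H) (I' : ModelWithCorners ℝ E' H')
    [TopologicalSpace M] [ChartedSpace H M] [TopologicalSpace M'] [ChartedSpace H' M']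
    (x : M) (y : M') : TangentSpace I' y →L[ℝ] TangentSpace (I.prod I') (x, y) :=
  ContinuousLinearMap.inr ℝ E E'

/-- The pair `(δx, δy)` in `T_{(x, y)}(M × N)`. -/
def tangentPair {E E' H H' M M' : Type*} [NormedAddCommGroup E] [NormedSpace ℝ E]
    [NormedAddCommGroup E'] [NormedSpace ℝ E'] [TopologicalSpace H] [TopologicalSpace H']
    (I : ModelWithCorners ℝ E H) (I' : ModelWithCorners ℝ E' H')
    [TopologicalSpace M] [ChartedSpace H M] [TopologicalSpace M'] [ChartedSpace H' M']
    {x : M} {y : M'} (δx : TangentSpace I x) (δy : TangentSpace I' y) :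
    TangentSpace (I.prod I') (x, y) :=
  ((δx, δy) : E × E')

/-- `D₁L(q₀, q₁) ∈ T*_{q₀}Q`. -/
def ForcedDMS.D₁L (q₀ q₁ : Q) : TangentSpace 𝓘(ℝ, EQ) q₀ →L[ℝ] ℝ :=
  (differential (𝓘(ℝ, EQ).prod 𝓘(ℝ, EQ)) S.L (q₀, q₁)).comp
    (tangentInl 𝓘(ℝ, EQ) 𝓘(ℝ, EQ) q₀ q₁)

/-- `D₂L(q₀, q₁) ∈ T*_{q₁}Q`. -/
def ForcedDMS.D₂L (q₀ q₁ : Q) : TangentSpace 𝓘(ℝ, EQ) q₁ →L[ℝ] ℝ :=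
  (differential (𝓘(ℝ, EQ).prod 𝓘(ℝ, EQ)) S.L (q₀, q₁)).comp
    (tangentInr 𝓘(ℝ, EQ) 𝓘(ℝ, EQ) q₀ q₁)

/-- `f⁻(q₀, q₁) ∈ T*_{q₀}Q`. -/
def ForcedDMS.fMinus (q₀ q₁ : Q) : TangentSpace 𝓘(ℝ, EQ) q₀ →L[ℝ] ℝ :=
  (S.f (q₀, q₁)).comp (tangentInl 𝓘(ℝ, EQ) 𝓘(ℝ, EQ) q₀ q₁)

/-- `f⁺(q₀, q₁) ∈ T*_{q₁}Q`. -/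
def ForcedDMS.fPlus (q₀ q₁ : Q) : TangentSpace 𝓘(ℝ, EQ) q₁ →L[ℝ] ℝ :=
  (S.f (q₀, q₁)).comp (tangentInr 𝓘(ℝ, EQ) 𝓘(ℝ, EQ) q₀ q₁)

/-- The discrete action `Σ_{k < N} L(q_k, q_{k+1})` of a discrete curve `(q_0, …, q_N)`. -/
def ForcedDMS.action (N : ℕ) (q : Fin (N + 1) → Q) : ℝ :=
  ∑ k : Fin N, S.L (q k.castSucc, q k.succ)

/-- The discrete Lagrange–d'Alembert principle: `dS(q)(δq) + Σ_k f(q_k, q_{k+1})(δq_k, δq_{k+1}) = 0`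
for all infinitesimal variations `δq` with fixed endpoints; `dS` is the differential of the discrete
action as a function on the product manifold `Q^{N+1}`. -/
def ForcedDMS.IsTrajectory {N : ℕ} (q : Fin (N + 1) → Q) : Prop :=
  ∀ δq : ∀ k, TangentSpace 𝓘(ℝ, EQ) (q k), δq 0 = 0 → δq (Fin.last N) = 0 →
    differential (ModelWithCorners.pi fun _ : Fin (N + 1) => 𝓘(ℝ, EQ)) (S.action N) q δq
      + ∑ k : Fin N, S.f (q k.castSucc, q k.succ)
          (tangentPair 𝓘(ℝ, EQ) 𝓘(ℝ, EQ) (δq k.castSucc) (δq k.succ)) = 0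

/-- The forced discrete Euler–Lagrange equations
`D₂L(q_{k-1}, q_k) + D₁L(q_k, q_{k+1}) + f⁺(q_{k-1}, q_k) + f⁻(q_k, q_{k+1}) = 0` in `T*_{q_k}Q`,
`1 ≤ k ≤ N - 1`; the Lean variable `k` is this index minus one. -/
def ForcedDMS.SatisfiesForcedDEL {N : ℕ} (q : Fin (N + 1) → Q) : Prop :=
  ∀ (k : ℕ) (h : k + 2 < N + 1),
    let q₀ : Q := q ⟨k, by omega⟩
    let q₁ : Q := q ⟨k + 1, by omega⟩
    let q₂ : Q := q ⟨k + 2, h⟩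
    S.D₂L q₀ q₁ + S.D₁L q₁ q₂ + S.fPlus q₀ q₁ + S.fMinus q₁ q₂ = 0

/-! ### The reduced system -/

/-- `Υ(q₀, q₁) = (ρ(q₀, 𝒜_d(q₀, q₁)), π(q₁))`. -/
def upsilon (p : Q × Q) : ConjBundle P × Base G Q :=
  (ConjBundle.rho P (p.1, A.form p), proj G p.2)

theorem upsilon_smul (g : G) (p : Q × Q) : upsilon P A (g • p) = upsilon P A p := by
  refine Prod.ext ?_ (proj_smul g p.2)
  show ConjBundle.rho P (g • p.1, A.form (g • p)) = ConjBundle.rho P (p.1, A.form p)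
  rw [A.form_smul P, ConjBundle.rho_smul]

/-- `Ψ̃(q₀, w₀, τ₁) = (q₀, w₀ • h_d^{q₀}(τ₁))`, the inverse of
`Φ̃(q₀, q₁) = (q₀, 𝒜_d(q₀, q₁), π(q₁))`. -/
def psiTilde (x : Q × G × Base G Q) : Q × Q := (x.1, x.2.1 • A.lift x.1 x.2.2)

/-- `Ľ = L ∘ Ψ̃` on `Q × G × Q / G`. -/
def ForcedDMS.Lcheck (x : Q × G × Base G Q) : ℝ := S.L (psiTilde A x)

/-- The reduced Lagrangian on `(Q × G) / G × Q / G`: `L̂(ρ(q, w), τ) = Ľ(q, w, τ)`. -/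
def ForcedDMS.Lhat (hS : S.IsSymmetric G) (x : ConjBundle P × Base G Q) : ℝ :=
  Quotient.lift (fun y : Q × G => S.Lcheck A (y.1, y.2, x.2))
    (by
      rintro _ y ⟨g, rfl⟩
      have h : psiTilde A (g • y.1, g * y.2 * g⁻¹, x.2) = g • psiTilde A (y.1, y.2, x.2) := by
        refine Prod.ext rfl ?_
        simp [psiTilde, A.lift_smul, mul_smul]
      simp only [ForcedDMS.Lcheck, h, hS.L_smul]) x.1

/-- `f̌ = Ψ̃* f`, a `1`-form on `Q × G × Q / G`. -/
def ForcedDMS.fcheck (x : Q × G × Base G Q) :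
    TangentSpace (𝓘(ℝ, EQ).prod (𝓘(ℝ, EG).prod 𝓘(ℝ, EB))) x →L[ℝ] ℝ :=
  (S.f (psiTilde A x)).comp
    (mfderiv (𝓘(ℝ, EQ).prod (𝓘(ℝ, EG).prod 𝓘(ℝ, EB))) (𝓘(ℝ, EQ).prod 𝓘(ℝ, EQ)) (psiTilde A) x)

/-- The inclusion of the first factor in `T_{(q, w, τ)}(Q × G × Q / G)`. -/
def incl₁ (q : Q) (w : G) (τ : Base G Q) : TangentSpace 𝓘(ℝ, EQ) q →L[ℝ]
    TangentSpace (𝓘(ℝ, EQ).prod (𝓘(ℝ, EG).prod 𝓘(ℝ, EB))) (q, w, τ) :=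
  tangentInl 𝓘(ℝ, EQ) (𝓘(ℝ, EG).prod 𝓘(ℝ, EB)) q (w, τ)

/-- The inclusion of the second factor. -/
def incl₂ (q : Q) (w : G) (τ : Base G Q) : TangentSpace 𝓘(ℝ, EG) w →L[ℝ]
    TangentSpace (𝓘(ℝ, EQ).prod (𝓘(ℝ, EG).prod 𝓘(ℝ, EB))) (q, w, τ) :=
  (tangentInr 𝓘(ℝ, EQ) (𝓘(ℝ, EG).prod 𝓘(ℝ, EB)) q (w, τ)).comp
    (tangentInl 𝓘(ℝ, EG) 𝓘(ℝ, EB) w τ)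

/-- The inclusion of the third factor. -/
def incl₃ (q : Q) (w : G) (τ : Base G Q) : TangentSpace 𝓘(ℝ, EB) τ →L[ℝ]
    TangentSpace (𝓘(ℝ, EQ).prod (𝓘(ℝ, EG).prod 𝓘(ℝ, EB))) (q, w, τ) :=
  (tangentInr 𝓘(ℝ, EQ) (𝓘(ℝ, EG).prod 𝓘(ℝ, EB)) q (w, τ)).comp
    (tangentInr 𝓘(ℝ, EG) 𝓘(ℝ, EB) w τ)

/-! ### The reduced force -/

variable (EG G Q) in
/-- The orbit equivalence relation of the action `g · ((q₀, q₁), ξ) = ((g q₀, g q₁), Ad_g ξ)`. -/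
def adjointSetoid : Setoid ((Q × Q) × GroupLieAlgebra 𝓘(ℝ, EG) G) where
  r x y := ∃ g : G, (g • y.1, Ad EG g y.2) = x
  iseqv :=
    { refl := fun x => ⟨1, Prod.ext (one_smul G x.1) (Ad_one x.2)⟩
      symm := by
        rintro x y ⟨g, rfl⟩
        refine ⟨g⁻¹, Prod.ext (inv_smul_smul g y.1) ?_⟩
        show Ad EG g⁻¹ (Ad EG g y.2) = y.2
        rw [← Ad_mul, inv_mul_cancel, Ad_one]
      trans := by
        rintro x y z ⟨g, rfl⟩ ⟨h, rfl⟩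
        exact ⟨g * h, Prod.ext (mul_smul g h z.1) (Ad_mul g h z.2)⟩ }

variable (EG G Q) in
/-- The adjoint bundle `(Q × Q × 𝔤) / G` of the principal bundle `Q × Q → (Q × Q) / G`. -/
def AdjointBundle : Type _ := Quotient (adjointSetoid EG G Q)

/-- The class `[(q₀, q₁), ξ]`. -/
def AdjointBundle.mk (p : Q × Q) (ξ : GroupLieAlgebra 𝓘(ℝ, EG) G) : AdjointBundle EG G Q :=
  Quotient.mk (adjointSetoid EG G Q) (p, ξ)

/-- The projection of the adjoint bundle to `(Q × Q) / G`, the latter being identified with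
`(Q × G) / G × Q / G` through the map induced by `Υ`. -/
def AdjointBundle.base (a : AdjointBundle EG G Q) : ConjBundle P × Base G Q :=
  Quotient.lift (fun y : (Q × Q) × GroupLieAlgebra 𝓘(ℝ, EG) G => upsilon P A y.1)
    (by rintro _ y ⟨g, rfl⟩; exact upsilon_smul P A g y.1) a

/-- The fibre over `x` of the pullback of the adjoint bundle to `(Q × G) / G × Q / G`. -/
def AdjointFibre (x : ConjBundle P × Base G Q) : Type _ :=
  {a : AdjointBundle EG G Q // a.base P A = x}

/-- `[(q₀, q₁), ξ]` as an element of the fibre over `Υ(q₀, q₁)`. -/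
def AdjointFibre.mk (p : Q × Q) (ξ : GroupLieAlgebra 𝓘(ℝ, EG) G) :
    AdjointFibre P A (upsilon P A p) :=
  ⟨AdjointBundle.mk p ξ, rfl⟩

/-- The principal connection `(δq₀, δq₁) ↦ ½ (𝔄(δq₀) + 𝔄(δq₁))` on `Q × Q → (Q × Q) / G`. -/
def PrincipalConnection.pairForm (p : Q × Q) (v : TangentSpace (𝓘(ℝ, EQ).prod 𝓘(ℝ, EQ)) p) :
    GroupLieAlgebra 𝓘(ℝ, EG) G :=
  (1 / 2 : ℝ) • (C.form p.1 (v : EQ × EQ).1 + C.form p.2 (v : EQ × EQ).2)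

/-- The reduced force, `f̂(v, τ)(X ⊕ a) = f(q₀, q₁)(δq₀, δq₁)` for any `(δq₀, δq₁)` in
`T_{(q₀, q₁)}(Q × Q)` with `TΥ(δq₀, δq₁) = X ∈ T_{(v, τ)}((Q × G) / G × Q / G)` and
`a = [(q₀, q₁), ½ (𝔄(δq₀) + 𝔄(δq₁))]`.  (The value does not depend on the choices when the system is
symmetric.) -/
def ForcedDMS.fhat (x : ConjBundle P × Base G Q)
    (X : TangentSpace ((𝓘(ℝ, EB).prod 𝓘(ℝ, EG)).prod 𝓘(ℝ, EB)) x) (a : AdjointFibre P A x) : ℝ :=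
  Classical.epsilon fun r : ℝ =>
    ∃ (p : Q × Q) (v : TangentSpace (𝓘(ℝ, EQ).prod 𝓘(ℝ, EQ)) p),
      tangentMap (𝓘(ℝ, EQ).prod 𝓘(ℝ, EQ)) ((𝓘(ℝ, EB).prod 𝓘(ℝ, EG)).prod 𝓘(ℝ, EB))
        (upsilon P A) ⟨p, v⟩ = ⟨x, X⟩ ∧
      AdjointBundle.mk p (C.pairForm p v) = a.1 ∧ r = S.f p v

/-! ### The reduced variational principle -/

/-- The reduced discrete action `Σ_{k < N} L̂(v_k, τ_{k+1})`, a function of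
`((v_0, τ_1), …, (v_{N-1}, τ_N))`. -/
def ForcedDMS.reducedAction (hS : S.IsSymmetric G) (N : ℕ)
    (c : Fin N → ConjBundle P × Base G Q) : ℝ :=
  ∑ k : Fin N, S.Lhat P A hS (c k)

/-- `T_{(q₀, w₀)}ρ(δq₀, T_{(q₀, q₁)}𝒜_d(δq₀, δq₁))`, where `w₀ = 𝒜_d(q₀, q₁)`. -/
def rhoVariation (q₀ q₁ : Q) (δq₀ : TangentSpace 𝓘(ℝ, EQ) q₀) (δq₁ : TangentSpace 𝓘(ℝ, EQ) q₁) :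
    TangentSpace (𝓘(ℝ, EB).prod 𝓘(ℝ, EG)) (ConjBundle.rho P (q₀, A.form (q₀, q₁))) :=
  mfderiv (𝓘(ℝ, EQ).prod 𝓘(ℝ, EG)) (𝓘(ℝ, EB).prod 𝓘(ℝ, EG)) (ConjBundle.rho P)
    (q₀, A.form (q₀, q₁))
    (tangentPair 𝓘(ℝ, EQ) 𝓘(ℝ, EG) δq₀
      (mfderiv (𝓘(ℝ, EQ).prod 𝓘(ℝ, EQ)) 𝓘(ℝ, EG) A.form (q₀, q₁)
        (tangentPair 𝓘(ℝ, EQ) 𝓘(ℝ, EQ) δq₀ δq₁)))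

/-- The reduced variational principle for the curve `((v_0, τ_1), …, (v_{N-1}, τ_N))`, where
`τ_k = π(q_k)`, `w_k = 𝒜_d(q_k, q_{k+1})` and `v_k = ρ(q_k, w_k)`. -/
def ForcedDMS.SatisfiesReducedPrinciple (hS : S.IsSymmetric G) {N : ℕ} (q : Fin (N + 1) → Q) :
    Prop :=
  let τ : Fin (N + 1) → Base G Q := fun k => proj G (q k)
  let w : Fin N → G := fun k => A.form (q k.castSucc, q k.succ)
  let v : Fin N → ConjBundle P := fun k => ConjBundle.rho P (q k.castSucc, w k)
  ∀ (δτ : ∀ k : Fin (N + 1), TangentSpace 𝓘(ℝ, EB) (τ k))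
    (δv : ∀ k : Fin N, TangentSpace (𝓘(ℝ, EB).prod 𝓘(ℝ, EG)) (v k))
    (ξ : Fin (N + 1) → GroupLieAlgebra 𝓘(ℝ, EG) G),
    (∀ k : Fin N, δv k =
      rhoVariation P A (q k.castSucc) (q k.succ)
        (horizontalLift P C (q k.castSucc) (δτ k.castSucc))
        (horizontalLift P C (q k.succ) (δτ k.succ))
      + rhoVariation P A (q k.castSucc) (q k.succ)
        (generator EG (q k.castSucc) (ξ k.castSucc))
        (generator EG (q k.succ) (ξ k.succ))) →
    δτ 0 = 0 → δτ (Fin.last N) = 0 → ξ 0 = 0 → ξ (Fin.last N) = 0 →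
    differential (ModelWithCorners.pi fun _ : Fin N => (𝓘(ℝ, EB).prod 𝓘(ℝ, EG)).prod 𝓘(ℝ, EB))
        (S.reducedAction P A hS N) (fun k => (v k, τ k.succ))
        (fun k => tangentPair (𝓘(ℝ, EB).prod 𝓘(ℝ, EG)) 𝓘(ℝ, EB) (δv k) (δτ k.succ))
      + ∑ k : Fin N, S.fhat P C A (v k, τ k.succ)
          (tangentPair (𝓘(ℝ, EB).prod 𝓘(ℝ, EG)) 𝓘(ℝ, EB) (δv k) (δτ k.succ))
          (AdjointFibre.mk P A (q k.castSucc, q k.succ)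
            ((1 / 2 : ℝ) • (ξ k.castSucc + ξ k.succ))) = 0

/-! ### The reduced equations -/

/-- The partial differential `D₁Ľ(q, w, τ) ∈ T*_q Q`. -/
def ForcedDMS.D₁Lcheck (q : Q) (w : G) (τ : Base G Q) : TangentSpace 𝓘(ℝ, EQ) q →L[ℝ] ℝ :=
  (differential (𝓘(ℝ, EQ).prod (𝓘(ℝ, EG).prod 𝓘(ℝ, EB))) (S.Lcheck A) (q, w, τ)).comp (incl₁ q w τ)

/-- `D₂Ľ(q, w, τ) ∈ T*_w G`. -/
def ForcedDMS.D₂Lcheck (q : Q) (w : G) (τ : Base G Q) : TangentSpace 𝓘(ℝ, EG) w →L[ℝ] ℝ :=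
  (differential (𝓘(ℝ, EQ).prod (𝓘(ℝ, EG).prod 𝓘(ℝ, EB))) (S.Lcheck A) (q, w, τ)).comp (incl₂ q w τ)

/-- `D₃Ľ(q, w, τ) ∈ T*_τ(Q / G)`. -/
def ForcedDMS.D₃Lcheck (q : Q) (w : G) (τ : Base G Q) : TangentSpace 𝓘(ℝ, EB) τ →L[ℝ] ℝ :=
  (differential (𝓘(ℝ, EQ).prod (𝓘(ℝ, EG).prod 𝓘(ℝ, EB))) (S.Lcheck A) (q, w, τ)).comp (incl₃ q w τ)

/-- The component `f̌¹(q, w, τ) ∈ T*_q Q` of `f̌ = f̌¹ + f̌² + f̌³`. -/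
def ForcedDMS.f₁check (q : Q) (w : G) (τ : Base G Q) : TangentSpace 𝓘(ℝ, EQ) q →L[ℝ] ℝ :=
  (S.fcheck A (q, w, τ)).comp (incl₁ q w τ)

/-- The component `f̌²(q, w, τ) ∈ T*_w G`. -/
def ForcedDMS.f₂check (q : Q) (w : G) (τ : Base G Q) : TangentSpace 𝓘(ℝ, EG) w →L[ℝ] ℝ :=
  (S.fcheck A (q, w, τ)).comp (incl₂ q w τ)

/-- The component `f̌³(q, w, τ) ∈ T*_τ(Q / G)`. -/
def ForcedDMS.f₃check (q : Q) (w : G) (τ : Base G Q) : TangentSpace 𝓘(ℝ, EB) τ →L[ℝ] ℝ :=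
  (S.fcheck A (q, w, τ)).comp (incl₃ q w τ)

/-- `D₁𝒜_d(q₀, q₁) : T_{q₀}Q → T_{𝒜_d(q₀, q₁)}G`. -/
def AffineDiscreteConnection.D₁form (q₀ q₁ : Q) :
    TangentSpace 𝓘(ℝ, EQ) q₀ →L[ℝ] TangentSpace 𝓘(ℝ, EG) (A.form (q₀, q₁)) :=
  (mfderiv (𝓘(ℝ, EQ).prod 𝓘(ℝ, EQ)) 𝓘(ℝ, EG) A.form (q₀, q₁)).comp
    (tangentInl 𝓘(ℝ, EQ) 𝓘(ℝ, EQ) q₀ q₁)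

/-- `D₂𝒜_d(q₀, q₁) : T_{q₁}Q → T_{𝒜_d(q₀, q₁)}G`. -/
def AffineDiscreteConnection.D₂form (q₀ q₁ : Q) :
    TangentSpace 𝓘(ℝ, EQ) q₁ →L[ℝ] TangentSpace 𝓘(ℝ, EG) (A.form (q₀, q₁)) :=
  (mfderiv (𝓘(ℝ, EQ).prod 𝓘(ℝ, EQ)) 𝓘(ℝ, EG) A.form (q₀, q₁)).comp
    (tangentInr 𝓘(ℝ, EQ) 𝓘(ℝ, EQ) q₀ q₁)

/-- For `α ∈ T*_w G`, the right translate `α w⁻¹ ∈ T*_e G = 𝔤*`: `(α w⁻¹)(ξ) = α(ξ w)`, where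
`ξ w = T_e R_w (ξ)`. -/
def mulRightInv (w : G) (α : TangentSpace 𝓘(ℝ, EG) w →L[ℝ] ℝ) :
    GroupLieAlgebra 𝓘(ℝ, EG) G →L[ℝ] ℝ :=
  (α : EG →L[ℝ] ℝ).comp (mfderiv 𝓘(ℝ, EG) 𝓘(ℝ, EG) (fun x : G => x * w) 1 : EG →L[ℝ] EG)

/-- The horizontal covector `φ ∈ T*_{π(q₁)}(Q / G)` at three consecutive points
`q₀ = q_{k-1}`, `q₁ = q_k`, `q₂ = q_{k+1}`. -/
def ForcedDMS.phi (q₀ q₁ q₂ : Q) : TangentSpace 𝓘(ℝ, EB) (proj G q₁) →L[ℝ] ℝ :=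
  let h := horizontalLift P C q₁
  let w₀ := A.form (q₀, q₁)
  let w₁ := A.form (q₁, q₂)
  let τ₁ := proj G q₁
  let τ₂ := proj G q₂
  (S.D₁Lcheck A q₁ w₁ τ₂).comp h + S.D₃Lcheck A q₀ w₀ τ₁
    + ((S.D₂Lcheck A q₁ w₁ τ₂).comp (A.D₁form q₁ q₂)).comp h
    + ((S.D₂Lcheck A q₀ w₀ τ₁).comp (A.D₂form q₀ q₁)).comp h
    + (S.f₁check A q₁ w₁ τ₂).comp h + S.f₃check A q₀ w₀ τ₁
    + ((S.f₂check A q₁ w₁ τ₂).comp (A.D₁form q₁ q₂)).comp h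
    + ((S.f₂check A q₀ w₀ τ₁).comp (A.D₂form q₀ q₁)).comp h

/-- The vertical covector `ψ ∈ 𝔤*` at three consecutive points
`q₀ = q_{k-1}`, `q₁ = q_k`, `q₂ = q_{k+1}`. -/
def ForcedDMS.psi (q₀ q₁ q₂ : Q) : GroupLieAlgebra 𝓘(ℝ, EG) G →L[ℝ] ℝ :=
  let w₀ := A.form (q₀, q₁)
  let w₁ := A.form (q₁, q₂)
  let τ₁ := proj G q₁
  let τ₂ := proj G q₂
  mulRightInv w₀ (S.D₂Lcheck A q₀ w₀ τ₁) - mulRightInv w₁ (S.D₂Lcheck A q₁ w₁ τ₂)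
    + (S.f₁check A q₁ w₁ τ₂ + (S.f₂check A q₁ w₁ τ₂).comp (A.D₁form q₁ q₂)
        + (S.f₂check A q₀ w₀ τ₁).comp (A.D₂form q₀ q₁)).comp (generator EG q₁)

/-- The reduced equations `φ = 0` and `ψ = 0` at all interior points `q_k`, `1 ≤ k ≤ N - 1`
(the Lean variable `k` is this index minus one). -/
def ForcedDMS.SatisfiesReducedEquations {N : ℕ} (q : Fin (N + 1) → Q) : Prop :=
  ∀ (k : ℕ) (h : k + 2 < N + 1),
    let q₀ : Q := q ⟨k, by omega⟩
    let q₁ : Q := q ⟨k + 1, by omega⟩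
    let q₂ : Q := q ⟨k + 2, h⟩
    S.phi P C A q₀ q₁ q₂ = 0 ∧ ∀ ξ : GroupLieAlgebra 𝓘(ℝ, EG) G, S.psi A q₀ q₁ q₂ ξ = 0

end System

end DiscreteReduction

end

/-!
The reduced statements are the unreduced ones read in other coordinates, and the proof makes this
precise on tangent vectors.

* The differential of the discrete action is a sum over the edges of the curve, so each variational
  principle is a statement about the covectors `α_k = dL + f` at the points `(q_k, q_{k+1})`.
  Summation by parts (`sum_edges_eq_zero_iff`) turns the Lagrange–d'Alembert principle into the
  cancellation of `α_{k-1}` and `α_k` at each interior `q_k`, which is the forced discrete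
  Euler–Lagrange equation.
* The principal connection splits `T_q Q` into horizontal lifts and infinitesimal generators
  (`rawLift_add_rawGenerator`). Hence the variations `δq` are exactly the
  `h(δτ_k) + (ξ_k)_Q(q_k)`, and a covector on `T_q Q` vanishes as soon as it does so on the two
  kinds of vectors.
* The map `TΥ` sends such a variation to the pair `(δv_k, δτ_{k+1})` of the reduced principle
  (`rawUpsilon_apply`), and `L = L̂ ∘ Υ`, so the Lagrangian terms of the two principles agree. For
  the force terms (`fhat_upsilon`) the point is that the reduced force is well defined: `TΥ` and
  `½ (𝔄 + 𝔄)` together are injective on `T_p(Q × Q)` (`eq_zero_of_rawUpsilon_eq_zero`), and pairs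
  of points and Lie algebra elements with the same class in the adjoint bundle differ by the action
  of some `g`.
* The covectors `φ` and `ψ` are the forced discrete Euler–Lagrange covector evaluated on horizontal
  and on vertical vectors (`phi_apply`, `psi_apply`). This is the chain rule for
  `(q₀, q₁) ↦ (q₀, 𝒜_d(q₀, q₁), π(q₁))`, together with the invariance of `L` and the infinitesimal
  form of `𝒜_d(q₀, g q₁) = g 𝒜_d(q₀, q₁)`.

All of this needs the smoothness of `ρ`, `𝒜_d`, `Ψ̃` and `L̂`, obtained in local trivializations of
`π` and from the local inverses of `Hor → Q × Q / G`. Differentials are handled as linear maps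
between the model spaces (`rawDeriv`), so that base points that are only propositionally equal cause
no change of type.
-/

noncomputable section

namespace DiscreteReduction

/-! ### Differentials read in the model spaces -/

section RawDeriv

variable {E₁ E₂ E₃ H₁ H₂ H₃ M₁ M₂ M₃ : Type*}
  [NormedAddCommGroup E₁] [NormedSpace ℝ E₁] [TopologicalSpace H₁]
  [NormedAddCommGroup E₂] [NormedSpace ℝ E₂] [TopologicalSpace H₂]
  [NormedAddCommGroup E₃] [NormedSpace ℝ E₃] [TopologicalSpace H₃]
  (I₁ : ModelWithCorners ℝ E₁ H₁) (I₂ : ModelWithCorners ℝ E₂ H₂) (I₃ : ModelWithCorners ℝ E₃ H₃)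
  [TopologicalSpace M₁] [ChartedSpace H₁ M₁]
  [TopologicalSpace M₂] [ChartedSpace H₂ M₂]
  [TopologicalSpace M₃] [ChartedSpace H₃ M₃]

/-- The differential of `f` at `x`, regarded as a linear map between the model vector spaces rather
than between the tangent spaces `T_x M₁` and `T_{f x} M₂` (which are copies of the model spaces).
Its type does not mention `x` or `f x`, so that base points can be rewritten. -/
def rawDeriv (f : M₁ → M₂) (x : M₁) : E₁ →L[ℝ] E₂ := mfderiv I₁ I₂ f x

variable {I₁ I₂ I₃}

theorem rawDeriv_congr {f g : M₁ → M₂} {x : M₁} (h : f =ᶠ[𝓝 x] g) :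
    rawDeriv I₁ I₂ f x = rawDeriv I₁ I₂ g x :=
  h.mfderiv_eq

/-- The chain rule, for a function that is locally a composition. -/
theorem rawDeriv_eq_comp {f : M₁ → M₂} {g : M₂ → M₃} {k : M₁ → M₃} {x : M₁} {y : M₂}
    (hg : MDifferentiableAt I₂ I₃ g y) (hf : MDifferentiableAt I₁ I₂ f x) (hy : f x = y)
    (h : k =ᶠ[𝓝 x] g ∘ f) :
    rawDeriv I₁ I₃ k x = (rawDeriv I₂ I₃ g y).comp (rawDeriv I₁ I₂ f x) := by
  subst hy
  rw [rawDeriv_congr h]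
  exact mfderiv_comp x hg hf

theorem rawDeriv_id (x : M₁) : rawDeriv I₁ I₁ (fun y : M₁ => y) x = ContinuousLinearMap.id ℝ E₁ :=
  mfderiv_id

theorem rawDeriv_const (x : M₁) (c : M₂) : rawDeriv I₁ I₂ (fun _ : M₁ => c) x = 0 :=
  mfderiv_const

theorem rawDeriv_fst (x : M₁ × M₂) :
    rawDeriv (I₁.prod I₂) I₁ (Prod.fst : M₁ × M₂ → M₁) x = ContinuousLinearMap.fst ℝ E₁ E₂ :=
  mfderiv_fst

theorem rawDeriv_snd (x : M₁ × M₂) :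
    rawDeriv (I₁.prod I₂) I₂ (Prod.snd : M₁ × M₂ → M₂) x = ContinuousLinearMap.snd ℝ E₁ E₂ :=
  mfderiv_snd

theorem rawDeriv_prodMk {f : M₁ → M₂} {g : M₁ → M₃} {x : M₁}
    (hf : MDifferentiableAt I₁ I₂ f x) (hg : MDifferentiableAt I₁ I₃ g x) :
    rawDeriv I₁ (I₂.prod I₃) (fun y => (f y, g y)) x =
      (rawDeriv I₁ I₂ f x).prod (rawDeriv I₁ I₃ g x) :=
  mfderiv_prodMk hf hg

/-- If `h` is a left inverse of `f` near `x`, the differential of `h` is a left inverse of that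
of `f`. -/
theorem rawDeriv_leftInverse {f : M₁ → M₂} {h : M₂ → M₁} {x : M₁} {y : M₂}
    (hh : MDifferentiableAt I₂ I₁ h y) (hf : MDifferentiableAt I₁ I₂ f x) (hy : f x = y)
    (hl : ∀ᶠ z in 𝓝 x, h (f z) = z) (v : E₁) :
    rawDeriv I₂ I₁ h y (rawDeriv I₁ I₂ f x v) = v := by
  have := rawDeriv_eq_comp (k := fun z : M₁ => z) hh hf hy
    (by filter_upwards [hl] with z hz using hz.symm)
  rw [rawDeriv_id] at this
  exact (DFunLike.congr_fun this v).symm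

end RawDeriv

/-! ### Finite products of manifolds -/

section Pi

variable {ι E H M : Type*} [Fintype ι]
  [NormedAddCommGroup E] [NormedSpace ℝ E] [TopologicalSpace H] (I : ModelWithCorners ℝ E H)
  [TopologicalSpace M] [ChartedSpace H M]

theorem extChartAt_pi_target_apply {x : ι → M} {y : ι → E}
    (hy : y ∈ (extChartAt (ModelWithCorners.pi fun _ : ι => I) x).target) (i : ι) :
    y i ∈ (extChartAt I (x i)).target := by
  rw [extChartAt_target] at hy ⊢
  refine ⟨?_, ?_⟩
  · exact hy.1 i (Set.mem_univ i)
  · obtain ⟨z, hz⟩ := hy.2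
    exact ⟨z i, congrFun hz i⟩

/-- The extended charts of a finite product are the products of the extended charts of the factors,
so in charts the evaluation at `i` is a coordinate projection. -/
theorem hasMFDerivAt_eval (i : ι) (x : ι → M) :
    HasMFDerivAt (ModelWithCorners.pi fun _ : ι => I) I (fun y : ι → M => y i) x
      (ContinuousLinearMap.proj (R := ℝ) (φ := fun _ : ι => E) i) := by
  refine ⟨(continuous_apply i).continuousAt, ?_⟩
  refine HasFDerivWithinAt.congr_of_eventuallyEq (ContinuousLinearMap.hasFDerivWithinAt
    (ContinuousLinearMap.proj (R := ℝ) (φ := fun _ : ι => E) i)) ?_ ?_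
  · filter_upwards [extChartAt_target_mem_nhdsWithin (I := ModelWithCorners.pi fun _ : ι => I) x]
      with y hy
    exact (extChartAt I (x i)).right_inv (extChartAt_pi_target_apply I hy i)
  · exact (extChartAt I (x i)).right_inv (extChartAt_pi_target_apply I (mem_extChartAt_target x) i)

theorem mdifferentiableAt_eval (i : ι) (x : ι → M) :
    MDifferentiableAt (ModelWithCorners.pi fun _ : ι => I) I (fun y : ι → M => y i) x :=
  (hasMFDerivAt_eval I i x).mdifferentiableAt

theorem rawDeriv_eval (i : ι) (x : ι → M) :
    rawDeriv (ModelWithCorners.pi fun _ : ι => I) I (fun y : ι → M => y i) x =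
      ContinuousLinearMap.proj (R := ℝ) (φ := fun _ : ι => E) i :=
  (hasMFDerivAt_eval I i x).mfderiv

/-- The differential of a sum of functions `F k`, each composed with a map `g k`. The index
type lives in the lowest universe because that of `HasMFDerivAt.sum` does. -/
theorem rawDeriv_sum_comp {κ : Type} [Fintype κ] {E' H' M' : Type*}
    [NormedAddCommGroup E'] [NormedSpace ℝ E'] [TopologicalSpace H'] {I' : ModelWithCorners ℝ E' H'}
    [TopologicalSpace M'] [ChartedSpace H' M'] {F : κ → M' → ℝ} {g : κ → M → M'} {x : M}
    (hF : ∀ k, MDifferentiableAt I' 𝓘(ℝ, ℝ) (F k) (g k x))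
    (hg : ∀ k, MDifferentiableAt I I' (g k) x) (v : E) :
    rawDeriv I 𝓘(ℝ, ℝ) (fun y => ∑ k, F k (g k y)) x v =
      ∑ k, rawDeriv I' 𝓘(ℝ, ℝ) (F k) (g k x) (rawDeriv I I' (g k) x v) := by
  classical
  have h0 : ∀ k, MDifferentiableAt I 𝓘(ℝ, ℝ) (fun y => F k (g k y)) x := fun k =>
    (hF k).comp x (hg k)
  have h := HasMFDerivAt.sum (I := I) (t := (Finset.univ : Finset κ))
    (f := fun k y => F k (g k y)) (fun k _ => (h0 k).hasMFDerivAt)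
  have h1 : (fun y => ∑ k, F k (g k y)) = ∑ k, (fun y => F k (g k y)) := by
    ext y; simp
  have h2 := h.mfderiv
  rw [← h1] at h2
  have h3 : ∀ k, rawDeriv I 𝓘(ℝ, ℝ) (fun y => F k (g k y)) x =
      (rawDeriv I' 𝓘(ℝ, ℝ) (F k) (g k x)).comp (rawDeriv I I' (g k) x) := fun k =>
    rawDeriv_eq_comp (hF k) (hg k) rfl Filter.EventuallyEq.rfl
  have h4 : rawDeriv I 𝓘(ℝ, ℝ) (fun y => ∑ k, F k (g k y)) x =
      ∑ k, rawDeriv I 𝓘(ℝ, ℝ) (fun y => F k (g k y)) x := h2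
  rw [h4]
  simp [h3]

end Pi

/-! ### Smoothness of the reduction maps -/

section Smoothness

variable {EQ EB EG G Q : Type*}
  [NormedAddCommGroup EQ] [NormedSpace ℝ EQ]
  [NormedAddCommGroup EB] [NormedSpace ℝ EB]
  [NormedAddCommGroup EG] [NormedSpace ℝ EG]
  [TopologicalSpace Q] [ChartedSpace EQ Q]
  [Group G] [TopologicalSpace G] [ChartedSpace EG G]
  [MulAction G Q] [ChartedSpace EB (Base G Q)]

namespace LocalTriv

variable (e : LocalTriv EQ EB EG G Q)

/-- The group component `χ` of a local trivialization `q ↦ (π q, χ q)`. -/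
def chi (q : Q) : G := (e.toOpenPartialHomeomorph q).2

theorem chi_smul (g : G) {q : Q} (h : proj G q ∈ e.baseSet) : e.chi (g • q) = g * e.chi q :=
  e.coe_smul_snd g h

theorem isOpen_proj_preimage : IsOpen {q : Q | proj G q ∈ e.baseSet} :=
  e.open_baseSet.preimage continuous_proj

theorem contMDiffAt_chi {q : Q} (h : proj G q ∈ e.baseSet) :
    ContMDiffAt 𝓘(ℝ, EQ) 𝓘(ℝ, EG) ∞ e.chi q :=
  contMDiffAt_snd.comp q
    (e.contMDiffOn_toFun.contMDiffAt (e.open_source.mem_nhds (e.mem_source.2 h)))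

theorem contMDiffAt_symm {y : Base G Q × G} (h : y.1 ∈ e.baseSet) :
    ContMDiffAt (𝓘(ℝ, EB).prod 𝓘(ℝ, EG)) 𝓘(ℝ, EQ) ∞ e.toOpenPartialHomeomorph.symm y :=
  e.contMDiffOn_invFun.contMDiffAt (e.open_target.mem_nhds (e.mem_target.2 h))

/-- In a local trivialization, `q = χ(q) • s(π q)` for the local section `s = (·, 1)`. -/
theorem symm_proj {q : Q} (h : proj G q ∈ e.baseSet) (g : G) :
    e.toOpenPartialHomeomorph.symm (proj G q, g) = (g * (e.chi q)⁻¹) • q := by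
  have h' : proj G ((g * (e.chi q)⁻¹) • q) ∈ e.baseSet := by rwa [proj_smul]
  have : e.toOpenPartialHomeomorph ((g * (e.chi q)⁻¹) • q) = (proj G q, g) := by
    refine Prod.ext ?_ ?_
    · rw [e.coe_fst h', proj_smul]
    · rw [e.coe_smul_snd _ h, ← chi]; simp
  rw [← this, e.toOpenPartialHomeomorph.left_inv (e.mem_source.2 h')]

end LocalTriv

namespace ConjBundle

variable (P : IsPrincipalBundle EQ EB EG G Q) [LieGroup 𝓘(ℝ, EG) ∞ G]
  [IsManifold 𝓘(ℝ, EB) ∞ (Base G Q)]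

/-- The local trivialization used for the chart at `v`. -/
def trivAt (v : ConjBundle P) : LocalTriv EQ EB EG G Q := (P.exists_localTriv (pr P v)).choose

theorem mem_trivAt (v : ConjBundle P) : pr P v ∈ (trivAt P v).baseSet :=
  (P.exists_localTriv (pr P v)).choose_spec

theorem mem_triv_target {e : LocalTriv EQ EB EG G Q} {y : Base G Q × G} :
    y ∈ (triv P e).target ↔ y.1 ∈ e.baseSet := by
  simp [triv]

/-- The chart at `v` is this trivialization followed by a chart `c` of `Q / G × G`; composing with
`c⁻¹` recovers the trivialization. -/
theorem contMDiffAt_trivAt (v : ConjBundle P) :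
    ContMDiffAt (𝓘(ℝ, EB).prod 𝓘(ℝ, EG)) (𝓘(ℝ, EB).prod 𝓘(ℝ, EG)) ∞ (triv P (trivAt P v)) v := by
  have : IsManifold 𝓘(ℝ, EG) ∞ G := LieGroup.toContMDiffMul.toIsManifold
  set t := triv P (trivAt P v)
  set c := chartAt (ModelProd EB EG) (t v)
  have h1 : ContMDiffAt (𝓘(ℝ, EB).prod 𝓘(ℝ, EG)) (𝓘(ℝ, EB).prod 𝓘(ℝ, EG)) ∞
      (chartAt (ModelProd EB EG) v) v :=
    contMDiffOn_chart.contMDiffAt (chart_source_mem_nhds _ _)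
  have h2 : ContMDiffAt (𝓘(ℝ, EB).prod 𝓘(ℝ, EG)) (𝓘(ℝ, EB).prod 𝓘(ℝ, EG)) ∞ c.symm (c (t v)) :=
    contMDiffOn_chart_symm.contMDiffAt (chart_target_mem_nhds _ _)
  refine (h2.comp v h1).congr_of_eventuallyEq ?_
  filter_upwards [chart_source_mem_nhds (ModelProd EB EG) v] with x hx
  exact (c.left_inv hx.2).symm

theorem contMDiffAt_trivAt_symm (v : ConjBundle P) :
    ContMDiffAt (𝓘(ℝ, EB).prod 𝓘(ℝ, EG)) (𝓘(ℝ, EB).prod 𝓘(ℝ, EG)) ∞ (triv P (trivAt P v)).symm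
      (triv P (trivAt P v) v) := by
  have : IsManifold 𝓘(ℝ, EG) ∞ G := LieGroup.toContMDiffMul.toIsManifold
  set t := triv P (trivAt P v)
  set c := chartAt (ModelProd EB EG) (t v)
  have h1 : ContMDiffAt (𝓘(ℝ, EB).prod 𝓘(ℝ, EG)) (𝓘(ℝ, EB).prod 𝓘(ℝ, EG)) ∞ c (t v) :=
    contMDiffOn_chart.contMDiffAt (chart_source_mem_nhds _ _)
  have h2 : ContMDiffAt (𝓘(ℝ, EB).prod 𝓘(ℝ, EG)) (𝓘(ℝ, EB).prod 𝓘(ℝ, EG)) ∞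
      (chartAt (ModelProd EB EG) v).symm (c (t v)) :=
    contMDiffOn_chart_symm.contMDiffAt (chart_target_mem_nhds (ModelProd EB EG) v)
  refine (h2.comp (t v) h1).congr_of_eventuallyEq ?_
  filter_upwards [chart_source_mem_nhds (ModelProd EB EG) (t v)] with x hx
  exact congrArg t.symm (c.left_inv hx).symm

/-- Every local trivialization is smooth: it differs from one underlying a chart by a smooth
transition map. -/
theorem contMDiffAt_triv (e : LocalTriv EQ EB EG G Q) {v : ConjBundle P}
    (hv : pr P v ∈ e.baseSet) :
    ContMDiffAt (𝓘(ℝ, EB).prod 𝓘(ℝ, EG)) (𝓘(ℝ, EB).prod 𝓘(ℝ, EG)) ∞ (triv P e) v := by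
  set t := triv P (trivAt P v)
  have hv' : v ∈ t.source := mem_trivAt P v
  have h1 := contMDiffAt_trivAt P v
  have hmem : t v ∈ (t.symm.trans (triv P e)).source := by
    refine ⟨t.map_source hv', ?_⟩
    show t.symm (t v) ∈ (triv P e).source
    rwa [t.left_inv hv']
  have h2 : ContMDiffAt (𝓘(ℝ, EB).prod 𝓘(ℝ, EG)) (𝓘(ℝ, EB).prod 𝓘(ℝ, EG)) ∞
      (t.symm.trans (triv P e)) (t v) :=
    (contMDiffOn_triv_symm_trans P (trivAt P v) e).contMDiffAt
      ((t.symm.trans (triv P e)).open_source.mem_nhds hmem)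
  refine (h2.comp v h1).congr_of_eventuallyEq ?_
  filter_upwards [t.open_source.mem_nhds hv'] with x hx
  exact congrArg (triv P e) (t.left_inv hx).symm

theorem contMDiffAt_triv_symm (e : LocalTriv EQ EB EG G Q) {y : Base G Q × G}
    (hy : y.1 ∈ e.baseSet) :
    ContMDiffAt (𝓘(ℝ, EB).prod 𝓘(ℝ, EG)) (𝓘(ℝ, EB).prod 𝓘(ℝ, EG)) ∞ (triv P e).symm y := by
  set v := (triv P e).symm y
  set t := triv P (trivAt P v)
  have hv' : v ∈ t.source := mem_trivAt P v
  have hy' : y ∈ (triv P e).target := (mem_triv_target P).2 hy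
  have hmem : y ∈ ((triv P e).symm.trans t).source := ⟨hy', hv'⟩
  have h2 : ContMDiffAt (𝓘(ℝ, EB).prod 𝓘(ℝ, EG)) (𝓘(ℝ, EB).prod 𝓘(ℝ, EG)) ∞
      ((triv P e).symm.trans t) y :=
    (contMDiffOn_triv_symm_trans P e (trivAt P v)).contMDiffAt
      (((triv P e).symm.trans t).open_source.mem_nhds hmem)
  have h1 := contMDiffAt_trivAt_symm P v
  refine (ContMDiffAt.comp y (g := t.symm) h1 h2).congr_of_eventuallyEq ?_
  filter_upwards [((triv P e).symm.trans t).open_source.mem_nhds hmem] with x hx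
  exact (t.left_inv hx.2).symm

/-- The quotient map `ρ` is smooth: in a local trivialization it is
`(q, w) ↦ (π q, χ(q)⁻¹ w χ(q))`. -/
theorem contMDiff_rho :
    ContMDiff (𝓘(ℝ, EQ).prod 𝓘(ℝ, EG)) (𝓘(ℝ, EB).prod 𝓘(ℝ, EG)) ∞ (rho P) := by
  rintro ⟨q, w⟩
  obtain ⟨e, he⟩ := P.exists_localTriv (proj G q)
  have hchi : ContMDiffAt (𝓘(ℝ, EQ).prod 𝓘(ℝ, EG)) 𝓘(ℝ, EG) ∞
      (fun x : Q × G => e.chi x.1) (q, w) :=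
    ContMDiffAt.comp (q, w) (g := e.chi) (e.contMDiffAt_chi he) contMDiffAt_fst
  have h1 : ContMDiffAt (𝓘(ℝ, EQ).prod 𝓘(ℝ, EG)) (𝓘(ℝ, EB).prod 𝓘(ℝ, EG)) ∞
      (fun x : Q × G => (proj G x.1, (e.chi x.1)⁻¹ * x.2 * e.chi x.1)) (q, w) :=
    (P.contMDiff_proj.contMDiffAt.comp (q, w) contMDiffAt_fst).prodMk
      ((hchi.inv.mul contMDiffAt_snd).mul hchi)
  refine (ContMDiffAt.comp (q, w) (contMDiffAt_triv_symm P e he) h1).congr_of_eventuallyEq ?_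
  filter_upwards [(e.isOpen_proj_preimage.preimage continuous_fst).mem_nhds he] with x hx
  have h2 := (triv P e).left_inv (x := rho P x) hx
  rw [← h2]
  exact congrArg (triv P e).symm (trivFun_rho P e hx x.2)

end ConjBundle

namespace AffineDiscreteConnection

variable (A : AffineDiscreteConnection EQ EB EG G Q)

theorem lift_proj {q q₁ : Q} (h : (q, q₁) ∈ A.Hor) : A.lift q (proj G q₁) = q₁ :=
  A.snd_eq (A.lift_mem _ _) h (A.proj_lift _ _)

theorem form_smul_lift (q₀ q₁ : Q) : A.form (q₀, q₁) • A.lift q₀ (proj G q₁) = q₁ := by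
  have h := A.lift_proj (A.form_spec (q₀, q₁))
  rw [proj_smul] at h
  rw [h, smul_inv_smul]

theorem form_smul_snd (P : IsPrincipalBundle EQ EB EG G Q) (g : G) (q₀ q₁ : Q) :
    A.form (q₀, g • q₁) = g * A.form (q₀, q₁) := by
  refine P.smul_inj (q := A.lift q₀ (proj G q₁)) ?_
  have h := A.form_smul_lift q₀ (g • q₁)
  rw [proj_smul] at h
  rw [h, mul_smul, form_smul_lift]

/-- The discrete horizontal lift is smooth, being a local inverse of the local diffeomorphism
`Hor → Q × Q / G`. -/
theorem contMDiff_lift : ContMDiff (𝓘(ℝ, EQ).prod 𝓘(ℝ, EB)) 𝓘(ℝ, EQ) ∞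
    (fun x : Q × Base G Q => A.lift x.1 x.2) := by
  rintro ⟨q, τ⟩
  let := A.chartedSpace
  obtain ⟨Φ, hΦ, hEq⟩ := A.isLocalDiffeomorph ⟨_, A.lift_mem q τ⟩
  have hx : ((q, τ) : Q × Base G Q) ∈ Φ.target := by
    have := Φ.map_source hΦ
    rw [← hEq hΦ] at this
    simpa [A.proj_lift] using this
  have h1 := Φ.contMDiffOn_invFun.contMDiffAt (Φ.open_target.mem_nhds hx)
  have h2 := A.isSmoothEmbedding.contMDiff.contMDiffAt (x := Φ.invFun (q, τ))
  refine (contMDiffAt_snd.comp (q, τ) (h2.comp (q, τ) h1)).congr_of_eventuallyEq ?_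
  filter_upwards [Φ.open_target.mem_nhds hx] with x hx
  have h3 : ((Φ.invFun x).1.1, proj G (Φ.invFun x).1.2) = x :=
    (hEq (Φ.map_target hx)).trans (Φ.right_inv hx)
  have h4 : A.lift (Φ.invFun x).1.1 (proj G (Φ.invFun x).1.2) = (Φ.invFun x).1.2 :=
    A.lift_proj (Φ.invFun x).2
  have h5 := congrArg (fun y : Q × Base G Q => A.lift y.1 y.2) h3
  exact h5.symm.trans h4

variable [LieGroup 𝓘(ℝ, EG) ∞ G]

theorem contMDiff_psiTilde [ContMDiffSMul 𝓘(ℝ, EG) 𝓘(ℝ, EQ) ∞ G Q] :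
    ContMDiff (𝓘(ℝ, EQ).prod (𝓘(ℝ, EG).prod 𝓘(ℝ, EB))) (𝓘(ℝ, EQ).prod 𝓘(ℝ, EQ)) ∞
      (psiTilde A) := by
  have h1 : ContMDiff (𝓘(ℝ, EQ).prod (𝓘(ℝ, EG).prod 𝓘(ℝ, EB))) (𝓘(ℝ, EQ).prod 𝓘(ℝ, EB)) ∞
      (fun x : Q × G × Base G Q => (x.1, x.2.2)) :=
    contMDiff_fst.prodMk (contMDiff_snd.comp contMDiff_snd)
  exact contMDiff_fst.prodMk ((contMDiff_fst.comp contMDiff_snd).smul (A.contMDiff_lift.comp h1))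

/-- The discrete connection form is smooth: in a local trivialization with group component `χ`,
`𝒜_d(q₀, q₁) = χ(q₁) χ(h_d^{q₀}(π q₁))⁻¹`. -/
theorem contMDiff_form (P : IsPrincipalBundle EQ EB EG G Q) :
    ContMDiff (𝓘(ℝ, EQ).prod 𝓘(ℝ, EQ)) 𝓘(ℝ, EG) ∞ A.form := by
  rintro ⟨q₀, q₁⟩
  obtain ⟨e, he⟩ := P.exists_localTriv (proj G q₁)
  have h1 : ContMDiff (𝓘(ℝ, EQ).prod 𝓘(ℝ, EQ)) (𝓘(ℝ, EQ).prod 𝓘(ℝ, EB)) ∞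
      (fun x : Q × Q => (x.1, proj G x.2)) :=
    contMDiff_fst.prodMk (P.contMDiff_proj.comp contMDiff_snd)
  have h2 : ContMDiffAt (𝓘(ℝ, EQ).prod 𝓘(ℝ, EQ)) 𝓘(ℝ, EG) ∞
      (fun x : Q × Q => e.chi (A.lift x.1 (proj G x.2))) (q₀, q₁) :=
    ContMDiffAt.comp (q₀, q₁) (g := e.chi) (e.contMDiffAt_chi (by rwa [A.proj_lift]))
      (A.contMDiff_lift.comp h1).contMDiffAt
  have h3 : ContMDiffAt (𝓘(ℝ, EQ).prod 𝓘(ℝ, EQ)) 𝓘(ℝ, EG) ∞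
      (fun x : Q × Q => e.chi x.2) (q₀, q₁) :=
    ContMDiffAt.comp (q₀, q₁) (g := e.chi) (e.contMDiffAt_chi he) contMDiffAt_snd
  refine (h3.mul h2.inv).congr_of_eventuallyEq ?_
  filter_upwards [(e.isOpen_proj_preimage.preimage continuous_snd).mem_nhds he] with x hx
  have h4 : e.chi (A.form x • A.lift x.1 (proj G x.2)) = e.chi x.2 :=
    congrArg e.chi (A.form_smul_lift x.1 x.2)
  rw [e.chi_smul _ (by rwa [A.proj_lift])] at h4
  simp [← h4]

end AffineDiscreteConnection

section Reduced

variable (P : IsPrincipalBundle EQ EB EG G Q) (A : AffineDiscreteConnection EQ EB EG G Q)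
  [LieGroup 𝓘(ℝ, EG) ∞ G] [IsManifold 𝓘(ℝ, EQ) ∞ Q] [ContMDiffSMul 𝓘(ℝ, EG) 𝓘(ℝ, EQ) ∞ G Q]
  [IsManifold 𝓘(ℝ, EB) ∞ (Base G Q)]

theorem psiTilde_form (q₀ q₁ : Q) : psiTilde A (q₀, A.form (q₀, q₁), proj G q₁) = (q₀, q₁) :=
  Prod.ext rfl (A.form_smul_lift q₀ q₁)

theorem contMDiff_upsilon : ContMDiff (𝓘(ℝ, EQ).prod 𝓘(ℝ, EQ))
    ((𝓘(ℝ, EB).prod 𝓘(ℝ, EG)).prod 𝓘(ℝ, EB)) ∞ (upsilon P A) :=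
  ((ConjBundle.contMDiff_rho P).comp (contMDiff_fst.prodMk (A.contMDiff_form P))).prodMk
    (P.contMDiff_proj.comp contMDiff_snd)

/-- The reduced Lagrangian is smooth, being `Ľ` composed with local sections of `ρ`. -/
theorem contMDiff_Lhat (S : ForcedDMS EQ Q) (hS : S.IsSymmetric G) :
    ContMDiff ((𝓘(ℝ, EB).prod 𝓘(ℝ, EG)).prod 𝓘(ℝ, EB)) 𝓘(ℝ, ℝ) ∞ (S.Lhat P A hS) := by
  rintro ⟨v, τ⟩
  obtain ⟨e, he⟩ := P.exists_localTriv (ConjBundle.pr P v)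
  have h1 : ContMDiffAt ((𝓘(ℝ, EB).prod 𝓘(ℝ, EG)).prod 𝓘(ℝ, EB)) (𝓘(ℝ, EB).prod 𝓘(ℝ, EG)) ∞
      (fun x : ConjBundle P × Base G Q => ConjBundle.triv P e x.1) (v, τ) :=
    ContMDiffAt.comp (v, τ) (ConjBundle.contMDiffAt_triv P e he) contMDiffAt_fst
  have h2 : ContMDiffAt ((𝓘(ℝ, EB).prod 𝓘(ℝ, EG)).prod 𝓘(ℝ, EB)) (𝓘(ℝ, EB).prod 𝓘(ℝ, EG)) ∞
      (fun x : ConjBundle P × Base G Q => ((ConjBundle.triv P e x.1).1, (1 : G))) (v, τ) :=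
    (contMDiffAt_fst.comp (v, τ) h1).prodMk contMDiffAt_const
  have h3 : ContMDiffAt ((𝓘(ℝ, EB).prod 𝓘(ℝ, EG)).prod 𝓘(ℝ, EB))
      (𝓘(ℝ, EQ).prod (𝓘(ℝ, EG).prod 𝓘(ℝ, EB))) ∞
      (fun x : ConjBundle P × Base G Q =>
        (e.toOpenPartialHomeomorph.symm ((ConjBundle.triv P e x.1).1, (1 : G)),
          (ConjBundle.triv P e x.1).2, x.2)) (v, τ) :=
    (ContMDiffAt.comp (v, τ)
      (e.contMDiffAt_symm (y := ((ConjBundle.triv P e v).1, (1 : G)))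
        ((ConjBundle.mem_triv_target P).1 ((ConjBundle.triv P e).map_source he))) h2).prodMk
      ((contMDiffAt_snd.comp (v, τ) h1).prodMk contMDiffAt_snd)
  have h4 : ContMDiff (𝓘(ℝ, EQ).prod (𝓘(ℝ, EG).prod 𝓘(ℝ, EB))) 𝓘(ℝ, ℝ) ∞ (S.Lcheck A) :=
    S.contMDiff_L.comp A.contMDiff_psiTilde
  refine (h4.contMDiffAt.comp (v, τ) h3).congr_of_eventuallyEq ?_
  filter_upwards [((e.open_baseSet.preimage (ConjBundle.continuous_pr P)).preimage
    continuous_fst).mem_nhds he] with x hx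
  have h5 := (ConjBundle.triv P e).left_inv (x := x.1) hx
  have h6 : S.Lhat P A hS x = S.Lhat P A hS
      ((ConjBundle.triv P e).symm (ConjBundle.triv P e x.1), x.2) := by rw [h5]
  exact h6

theorem Lhat_upsilon (S : ForcedDMS EQ Q) (hS : S.IsSymmetric G) (p : Q × Q) :
    S.Lhat P A hS (upsilon P A p) = S.L p :=
  congrArg S.L (psiTilde_form A p.1 p.2)

end Reduced

end Smoothness

/-! ### Vertical and horizontal vectors -/

section Vertical

variable (EQ EB EG G : Type*) {Q : Type*}
  [NormedAddCommGroup EQ] [NormedSpace ℝ EQ]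
  [NormedAddCommGroup EB] [NormedSpace ℝ EB]
  [NormedAddCommGroup EG] [NormedSpace ℝ EG]
  [TopologicalSpace Q] [ChartedSpace EQ Q]
  [Group G] [TopologicalSpace G] [ChartedSpace EG G]
  [MulAction G Q] [ChartedSpace EB (Base G Q)]

/-- The infinitesimal generator `ξ ↦ ξ_Q(q)`, between model spaces. -/
def rawGenerator (q : Q) : EG →L[ℝ] EQ := rawDeriv 𝓘(ℝ, EG) 𝓘(ℝ, EQ) (fun g : G => g • q) 1

/-- The differential `T_q π`, between model spaces. -/
def rawProj (q : Q) : EQ →L[ℝ] EB := rawDeriv 𝓘(ℝ, EQ) 𝓘(ℝ, EB) (proj G : Q → Base G Q) q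

variable {EQ EB EG G}
variable [LieGroup 𝓘(ℝ, EG) ∞ G] [IsManifold 𝓘(ℝ, EQ) ∞ Q] [ContMDiffSMul 𝓘(ℝ, EG) 𝓘(ℝ, EQ) ∞ G Q]

theorem mdifferentiableAt_smul_left (q : Q) (g : G) :
    MDifferentiableAt 𝓘(ℝ, EG) 𝓘(ℝ, EQ) (fun g : G => g • q) g :=
  ((contMDiff_id.smul contMDiff_const : ContMDiff 𝓘(ℝ, EG) 𝓘(ℝ, EQ) ∞
    ((id : G → G) • (fun _ : G => q))) g).mdifferentiableAt (by simp)

theorem mdifferentiableAt_smul_right (P : IsPrincipalBundle EQ EB EG G Q) (g : G) (q : Q) :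
    MDifferentiableAt 𝓘(ℝ, EQ) 𝓘(ℝ, EQ) (fun q : Q => g • q) q :=
  ((ContMDiff.smul (I := 𝓘(ℝ, EG)) contMDiff_const contMDiff_id :
    ContMDiff 𝓘(ℝ, EQ) 𝓘(ℝ, EQ) ∞ ((fun _ : Q => g) • (id : Q → Q))) q).mdifferentiableAt (by simp)

theorem mdifferentiableAt_proj (P : IsPrincipalBundle EQ EB EG G Q) (q : Q) :
    MDifferentiableAt 𝓘(ℝ, EQ) 𝓘(ℝ, EB) (proj G : Q → Base G Q) q :=
  (P.contMDiff_proj q).mdifferentiableAt (by simp)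

theorem rawProj_rawGenerator (P : IsPrincipalBundle EQ EB EG G Q) (q : Q) (ξ : EG) :
    rawProj EQ EB G q (rawGenerator EQ EG G q ξ) = 0 :=
  DFunLike.congr_fun (mfderiv_proj_generator P q) ξ

/-- A vector annihilated by `T_q π` is the value at `q` of an infinitesimal generator: in a local
trivialization `(π, χ)` it only moves the component `χ`, that is, it is tangent to the orbit. -/
theorem exists_rawGenerator_eq (P : IsPrincipalBundle EQ EB EG G Q) {q : Q} {v : EQ}
    (hv : rawProj EQ EB G q v = 0) :
    ∃ ξ : EG, rawGenerator EQ EG G q ξ = v := by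
  obtain ⟨e, he⟩ := P.exists_localTriv (proj G q)
  have hχ : MDifferentiableAt 𝓘(ℝ, EQ) 𝓘(ℝ, EG) e.chi q :=
    (e.contMDiffAt_chi he).mdifferentiableAt (by simp)
  have hs : MDifferentiableAt (𝓘(ℝ, EB).prod 𝓘(ℝ, EG)) 𝓘(ℝ, EQ) e.toOpenPartialHomeomorph.symm
      (proj G q, e.chi q) :=
    (e.contMDiffAt_symm (y := (proj G q, e.chi q)) he).mdifferentiableAt (by simp)
  have hπ := mdifferentiableAt_proj P q
  have h1 := rawDeriv_leftInverse (f := fun x => (proj G x, e.chi x)) hs (hπ.prodMk hχ) rfl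
    (by
      filter_upwards [e.isOpen_proj_preimage.mem_nhds he] with x hx
      simp [e.symm_proj hx]) v
  rw [rawDeriv_prodMk hπ hχ] at h1
  have h2 : MDifferentiableAt 𝓘(ℝ, EG) (𝓘(ℝ, EB).prod 𝓘(ℝ, EG))
      (fun g : G => (proj G q, g)) (e.chi q) :=
    mdifferentiableAt_const.prodMk mdifferentiableAt_id
  have h3 : MDifferentiableAt 𝓘(ℝ, EG) 𝓘(ℝ, EG) (fun g : G => g * (e.chi q)⁻¹) (e.chi q) :=
    ((contMDiff_id.mul contMDiff_const : ContMDiff 𝓘(ℝ, EG) 𝓘(ℝ, EG) ∞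
      (fun g : G => g * (e.chi q)⁻¹)) _).mdifferentiableAt (by simp)
  have h4 := rawDeriv_eq_comp (k := fun g : G => (g * (e.chi q)⁻¹) • q) hs h2 rfl
    (Filter.Eventually.of_forall fun g => (e.symm_proj he g).symm)
  have h5 := rawDeriv_eq_comp (k := fun g : G => (g * (e.chi q)⁻¹) • q)
    (mdifferentiableAt_smul_left (EQ := EQ) (EG := EG) q (1 : G)) h3 (by simp)
    Filter.EventuallyEq.rfl
  have h6 : rawDeriv 𝓘(ℝ, EG) (𝓘(ℝ, EB).prod 𝓘(ℝ, EG)) (fun g : G => (proj G q, g)) (e.chi q) =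
      ContinuousLinearMap.prod 0 (ContinuousLinearMap.id ℝ EG) := by
    have h : MDifferentiableAt 𝓘(ℝ, EG) 𝓘(ℝ, EG) (fun g : G => g) (e.chi q) := mdifferentiableAt_id
    rw [rawDeriv_prodMk mdifferentiableAt_const h, rawDeriv_const, rawDeriv_id]
  refine ⟨rawDeriv 𝓘(ℝ, EG) 𝓘(ℝ, EG) (fun g : G => g * (e.chi q)⁻¹) (e.chi q)
    (rawDeriv 𝓘(ℝ, EQ) 𝓘(ℝ, EG) e.chi q v), ?_⟩
  rw [h4, h6] at h5
  have h7 := DFunLike.congr_fun h5 (rawDeriv 𝓘(ℝ, EQ) 𝓘(ℝ, EG) e.chi q v)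
  refine h7.symm.trans (Eq.trans ?_ h1)
  simp only [ContinuousLinearMap.comp_apply, ContinuousLinearMap.prod_apply]
  congr 2
  exact hv.symm

variable (P : IsPrincipalBundle EQ EB EG G Q) (C : PrincipalConnection EQ EG G Q)

/-- The connection form, between model spaces. -/
def PrincipalConnection.rawForm (q : Q) : EQ →L[ℝ] EG := C.form q

/-- The horizontal lift, between model spaces. -/
def rawLift (q : Q) : EB →L[ℝ] EQ := horizontalLift P C q

theorem rawForm_rawGenerator (q : Q) (ξ : EG) : C.rawForm q (rawGenerator EQ EG G q ξ) = ξ :=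
  C.form_generator q ξ

theorem rawForm_rawLift (q : Q) (w : EB) : C.rawForm q (rawLift P C q w) = 0 :=
  ((exists_horizontalLift P C q).choose_spec w).1

theorem rawProj_rawLift (q : Q) (w : EB) : rawProj EQ EB G q (rawLift P C q w) = w :=
  ((exists_horizontalLift P C q).choose_spec w).2

/-- The splitting of a tangent vector into its horizontal and its vertical part. -/
theorem rawLift_add_rawGenerator (q : Q) (v : EQ) :
    rawLift P C q (rawProj EQ EB G q v) + rawGenerator EQ EG G q (C.rawForm q v) = v := by
  obtain ⟨ξ, hξ⟩ := exists_rawGenerator_eq P (q := q)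
    (v := v - (rawLift P C q (rawProj EQ EB G q v) + rawGenerator EQ EG G q (C.rawForm q v)))
    (by simp [rawProj_rawLift, rawProj_rawGenerator P])
  have h := congrArg (C.rawForm q) hξ
  rw [rawForm_rawGenerator] at h
  simp only [map_sub, map_add, rawForm_rawLift, rawForm_rawGenerator, zero_add, sub_self] at h
  rw [h, map_zero] at hξ
  exact (sub_eq_zero.1 hξ.symm).symm

end Vertical

/-! ### Differentials of the reduction maps -/

section Reduction

variable {EQ EB EG G Q : Type*}
  [NormedAddCommGroup EQ] [NormedSpace ℝ EQ]
  [NormedAddCommGroup EB] [NormedSpace ℝ EB]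
  [NormedAddCommGroup EG] [NormedSpace ℝ EG]
  [TopologicalSpace Q] [ChartedSpace EQ Q]
  [Group G] [TopologicalSpace G] [ChartedSpace EG G]
  [MulAction G Q] [ChartedSpace EB (Base G Q)]
  [LieGroup 𝓘(ℝ, EG) ∞ G] [IsManifold 𝓘(ℝ, EQ) ∞ Q] [ContMDiffSMul 𝓘(ℝ, EG) 𝓘(ℝ, EQ) ∞ G Q]
  [IsManifold 𝓘(ℝ, EB) ∞ (Base G Q)]

/-- The differential of a function invariant under the diagonal action vanishes on the
infinitesimal generators of that action. -/
theorem rawDeriv_generator_eq_zero {E H M : Type*} [NormedAddCommGroup E] [NormedSpace ℝ E]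
    [TopologicalSpace H] {I : ModelWithCorners ℝ E H} [TopologicalSpace M] [ChartedSpace H M]
    {F : Q × Q → M} {p : Q × Q} (hF : MDifferentiableAt (𝓘(ℝ, EQ).prod 𝓘(ℝ, EQ)) I F p)
    (hinv : ∀ g : G, F (g • p) = F p) (ξ : EG) :
    rawDeriv (𝓘(ℝ, EQ).prod 𝓘(ℝ, EQ)) I F p
      (rawGenerator EQ EG G p.1 ξ, rawGenerator EQ EG G p.2 ξ) = 0 := by
  have h1 := mdifferentiableAt_smul_left (EQ := EQ) (EG := EG) p.1 (1 : G)
  have h2 := mdifferentiableAt_smul_left (EQ := EQ) (EG := EG) p.2 (1 : G)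
  have h3 := rawDeriv_eq_comp (k := fun _ : G => F p) hF (h1.prodMk h2)
    (Prod.ext (one_smul G p.1) (one_smul G p.2))
    (Filter.Eventually.of_forall fun g => (hinv g).symm)
  rw [rawDeriv_prodMk h1 h2, rawDeriv_const] at h3
  exact (DFunLike.congr_fun h3 ξ).symm

/-- The chain rule for `g ↦ F (q₀, g • q₁)`. -/
theorem rawDeriv_smul_snd {E H M : Type*} [NormedAddCommGroup E] [NormedSpace ℝ E]
    [TopologicalSpace H] {I : ModelWithCorners ℝ E H} [TopologicalSpace M] [ChartedSpace H M]
    {F : Q × Q → M} {q₀ q₁ : Q}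
    (hF : MDifferentiableAt (𝓘(ℝ, EQ).prod 𝓘(ℝ, EQ)) I F (q₀, q₁)) (ξ : EG) :
    rawDeriv 𝓘(ℝ, EG) I (fun g : G => F (q₀, g • q₁)) 1 ξ =
      rawDeriv (𝓘(ℝ, EQ).prod 𝓘(ℝ, EQ)) I F (q₀, q₁) (0, rawGenerator EQ EG G q₁ ξ) := by
  have h1 : MDifferentiableAt 𝓘(ℝ, EG) 𝓘(ℝ, EQ) (fun _ : G => q₀) 1 := mdifferentiableAt_const
  have h2 := mdifferentiableAt_smul_left (EQ := EQ) (EG := EG) q₁ (1 : G)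
  rw [rawDeriv_eq_comp (k := fun g : G => F (q₀, g • q₁)) hF (h1.prodMk h2)
    (Prod.ext rfl (one_smul G q₁)) Filter.EventuallyEq.rfl, rawDeriv_prodMk h1 h2, rawDeriv_const]
  rfl

theorem mdifferentiableAt_form (P : IsPrincipalBundle EQ EB EG G Q)
    (A : AffineDiscreteConnection EQ EB EG G Q) (p : Q × Q) :
    MDifferentiableAt (𝓘(ℝ, EQ).prod 𝓘(ℝ, EQ)) 𝓘(ℝ, EG) A.form p :=
  (A.contMDiff_form P p).mdifferentiableAt (by simp)

/-- The differential of the discrete connection form, between model spaces. -/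
def AffineDiscreteConnection.rawForm (A : AffineDiscreteConnection EQ EB EG G Q) (p : Q × Q) :
    EQ × EQ →L[ℝ] EG :=
  rawDeriv (𝓘(ℝ, EQ).prod 𝓘(ℝ, EQ)) 𝓘(ℝ, EG) A.form p

/-- The infinitesimal version of `𝒜_d(q₀, g q₁) = g 𝒜_d(q₀, q₁)`. -/
theorem rawForm_zero_generator (P : IsPrincipalBundle EQ EB EG G Q)
    (A : AffineDiscreteConnection EQ EB EG G Q) (q₀ q₁ : Q) (ξ : EG) :
    A.rawForm (q₀, q₁) (0, rawGenerator EQ EG G q₁ ξ) =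
      rawDeriv 𝓘(ℝ, EG) 𝓘(ℝ, EG) (fun g : G => g * A.form (q₀, q₁)) 1 ξ := by
  rw [AffineDiscreteConnection.rawForm, ← rawDeriv_smul_snd (mdifferentiableAt_form P A _)]
  simp only [A.form_smul_snd P]

variable (P : IsPrincipalBundle EQ EB EG G Q)
  (C : PrincipalConnection EQ EG G Q) (A : AffineDiscreteConnection EQ EB EG G Q)

theorem mdifferentiableAt_upsilon (p : Q × Q) : MDifferentiableAt (𝓘(ℝ, EQ).prod 𝓘(ℝ, EQ))
    ((𝓘(ℝ, EB).prod 𝓘(ℝ, EG)).prod 𝓘(ℝ, EB)) (upsilon P A) p :=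
  (contMDiff_upsilon P A p).mdifferentiableAt (by simp)

/-- The differential of `Υ`, between model spaces. -/
def rawUpsilon (p : Q × Q) : EQ × EQ →L[ℝ] (EB × EG) × EB :=
  rawDeriv (𝓘(ℝ, EQ).prod 𝓘(ℝ, EQ)) ((𝓘(ℝ, EB).prod 𝓘(ℝ, EG)).prod 𝓘(ℝ, EB)) (upsilon P A) p

/-- `TΥ` sends `(δq₀, δq₁)` to the pair `(δv, δτ)` of the reduced variational principle. -/
theorem rawUpsilon_apply (q₀ q₁ : Q) (v : EQ × EQ) :
    rawUpsilon P A (q₀, q₁) v =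
      ((rhoVariation P A q₀ q₁ v.1 v.2 : EB × EG), rawProj EQ EB G q₁ v.2) := by
  have h0 : MDifferentiableAt (𝓘(ℝ, EQ).prod 𝓘(ℝ, EQ)) 𝓘(ℝ, EQ) (Prod.fst : Q × Q → Q) (q₀, q₁) :=
    mdifferentiableAt_fst
  have h0' : MDifferentiableAt (𝓘(ℝ, EQ).prod 𝓘(ℝ, EQ)) 𝓘(ℝ, EQ) (Prod.snd : Q × Q → Q) (q₀, q₁) :=
    mdifferentiableAt_snd
  have h1 := mdifferentiableAt_form P A (q₀, q₁)
  have h2 : MDifferentiableAt (𝓘(ℝ, EQ).prod 𝓘(ℝ, EG)) (𝓘(ℝ, EB).prod 𝓘(ℝ, EG))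
      (ConjBundle.rho P) (q₀, A.form (q₀, q₁)) :=
    (ConjBundle.contMDiff_rho P _).mdifferentiableAt (by simp)
  have h3 := mdifferentiableAt_proj P q₁
  have h4 := rawDeriv_eq_comp (k := fun p : Q × Q => ConjBundle.rho P (p.1, A.form p)) h2
    (h0.prodMk h1) rfl Filter.EventuallyEq.rfl
  have h5 := rawDeriv_eq_comp (k := fun p : Q × Q => (proj G p.2 : Base G Q)) h3 h0' rfl
    Filter.EventuallyEq.rfl
  have h6 := rawDeriv_prodMk (h2.comp (q₀, q₁) (h0.prodMk h1)) (h3.comp (q₀, q₁) h0')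
  refine (DFunLike.congr_fun h6 v).trans ?_
  refine Prod.ext ?_ ?_
  · refine (DFunLike.congr_fun h4 v).trans ?_
    rw [rawDeriv_prodMk h0 h1, rawDeriv_fst]
    rfl
  · refine (DFunLike.congr_fun h5 v).trans ?_
    rw [rawDeriv_snd]
    rfl

theorem ConjBundle.mdifferentiableAt_pr (v : ConjBundle P) :
    MDifferentiableAt (𝓘(ℝ, EB).prod 𝓘(ℝ, EG)) 𝓘(ℝ, EB) (ConjBundle.pr P) v := by
  obtain ⟨e, he⟩ := P.exists_localTriv (ConjBundle.pr P v)
  have h := (contMDiffAt_fst.comp v (ConjBundle.contMDiffAt_triv P e he)).mdifferentiableAt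
    (by simp)
  have h1 : Prod.fst ∘ ConjBundle.triv P e = ConjBundle.pr P := by
    ext x
    obtain ⟨x, rfl⟩ := ConjBundle.rho_surjective P x
    rfl
  rwa [h1] at h

/-- A vector annihilated by `TΥ` has vertical first component, as `π(q₀)` is the base point of the
first component of `Υ(q₀, q₁)`. -/
theorem rawProj_fst_eq_zero {p : Q × Q} {v : EQ × EQ} (hv : rawUpsilon P A p v = 0) :
    rawProj EQ EB G p.1 v.1 = 0 := by
  have h0 : MDifferentiableAt (𝓘(ℝ, EQ).prod 𝓘(ℝ, EQ)) 𝓘(ℝ, EQ) (Prod.fst : Q × Q → Q) p :=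
    mdifferentiableAt_fst
  have h1 := rawDeriv_eq_comp (k := fun p : Q × Q => (proj G p.1 : Base G Q))
    (mdifferentiableAt_proj P p.1) h0 rfl Filter.EventuallyEq.rfl
  have h2 : MDifferentiableAt ((𝓘(ℝ, EB).prod 𝓘(ℝ, EG)).prod 𝓘(ℝ, EB)) 𝓘(ℝ, EB)
      (fun x : ConjBundle P × Base G Q => ConjBundle.pr P x.1) (upsilon P A p) :=
    (ConjBundle.mdifferentiableAt_pr P _).comp (upsilon P A p) mdifferentiableAt_fst
  have h3 := rawDeriv_eq_comp (k := fun p : Q × Q => (proj G p.1 : Base G Q)) h2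
    (mdifferentiableAt_upsilon P A p) rfl Filter.EventuallyEq.rfl
  rw [h1, rawDeriv_fst] at h3
  have h4 := DFunLike.congr_fun h3 v
  have h5 : rawDeriv (𝓘(ℝ, EQ).prod 𝓘(ℝ, EQ)) ((𝓘(ℝ, EB).prod 𝓘(ℝ, EG)).prod 𝓘(ℝ, EB))
      (upsilon P A) p v = 0 := hv
  rw [ContinuousLinearMap.comp_apply, ContinuousLinearMap.comp_apply, h5, map_zero] at h4
  exact h4

/-- `g ↦ Υ(q₀, g q₁)` is an immersion at `1`: in a local trivialization with group component `χ`,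
its group component is `χ(q₀)⁻¹ g 𝒜_d(q₀, q₁) χ(q₀)`, from which `g` can be recovered. -/
theorem eq_zero_of_rawUpsilon_zero_generator {q₀ q₁ : Q} {ξ : EG}
    (h : rawUpsilon P A (q₀, q₁) (0, rawGenerator EQ EG G q₁ ξ) = 0) : ξ = 0 := by
  obtain ⟨e, he⟩ := P.exists_localTriv (proj G q₀)
  let r : ConjBundle P × Base G Q → G := fun x =>
    e.chi q₀ * (ConjBundle.triv P e x.1).2 * ((e.chi q₀)⁻¹ * (A.form (q₀, q₁))⁻¹)
  have hr : MDifferentiableAt ((𝓘(ℝ, EB).prod 𝓘(ℝ, EG)).prod 𝓘(ℝ, EB)) 𝓘(ℝ, EG) r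
      (upsilon P A (q₀, q₁)) := by
    have h1 : ContMDiffAt ((𝓘(ℝ, EB).prod 𝓘(ℝ, EG)).prod 𝓘(ℝ, EB)) (𝓘(ℝ, EB).prod 𝓘(ℝ, EG)) ∞
        (fun x : ConjBundle P × Base G Q => ConjBundle.triv P e x.1) (upsilon P A (q₀, q₁)) :=
      ContMDiffAt.comp (upsilon P A (q₀, q₁))
        (ConjBundle.contMDiffAt_triv P e (v := (upsilon P A (q₀, q₁)).1) he) contMDiffAt_fst
    have h2 : ContMDiffAt ((𝓘(ℝ, EB).prod 𝓘(ℝ, EG)).prod 𝓘(ℝ, EB)) 𝓘(ℝ, EG) ∞ r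
        (upsilon P A (q₀, q₁)) :=
      (contMDiffAt_const.mul (contMDiffAt_snd.comp (upsilon P A (q₀, q₁)) h1)).mul
        contMDiffAt_const
    exact h2.mdifferentiableAt (by simp)
  have hf : MDifferentiableAt 𝓘(ℝ, EG) ((𝓘(ℝ, EB).prod 𝓘(ℝ, EG)).prod 𝓘(ℝ, EB))
      (fun g : G => upsilon P A (q₀, g • q₁)) 1 :=
    MDifferentiableAt.comp_of_eq (f := fun g : G => (q₀, g • q₁)) (x := 1)
      (y := (q₀, q₁)) (mdifferentiableAt_upsilon P A (q₀, q₁))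
      (mdifferentiableAt_const.prodMk (mdifferentiableAt_smul_left q₁ 1))
      (Prod.ext rfl (one_smul G q₁))
  have key := rawDeriv_leftInverse (x := (1 : G)) (y := upsilon P A (q₀, q₁)) hr hf
    (by simp) (Filter.Eventually.of_forall fun g => by
      have h1 := ConjBundle.trivFun_rho P e he (A.form (q₀, g • q₁))
      have h2 : (ConjBundle.triv P e (upsilon P A (q₀, g • q₁)).1).2 =
        (e.chi q₀)⁻¹ * A.form (q₀, g • q₁) * e.chi q₀ := congrArg Prod.snd h1
      simp only [r]
      rw [h2, A.form_smul_snd P]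
      group) ξ
  rw [rawDeriv_smul_snd (mdifferentiableAt_upsilon P A (q₀, q₁))] at key
  rw [← key]
  exact (congrArg _ h).trans (map_zero _)

/-- `TΥ` together with the principal connection `½ (𝔄 + 𝔄)` on `Q × Q` is injective. -/
theorem eq_zero_of_rawUpsilon_eq_zero {p : Q × Q} {v : EQ × EQ} (hv : rawUpsilon P A p v = 0)
    (hC : C.rawForm p.1 v.1 + C.rawForm p.2 v.2 = 0) : v = 0 := by
  obtain ⟨q₀, q₁⟩ := p
  obtain ⟨v₀, v₁⟩ := v
  obtain ⟨ξ₀, h0⟩ := exists_rawGenerator_eq P (rawProj_fst_eq_zero P A hv)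
  obtain ⟨ξ₁, h1⟩ := exists_rawGenerator_eq P
    (congrArg Prod.snd ((rawUpsilon_apply P A q₀ q₁ (v₀, v₁)).symm.trans hv))
  simp only at h0 h1 hC
  subst h0 h1
  rw [rawForm_rawGenerator, rawForm_rawGenerator] at hC
  have h2 : rawUpsilon P A (q₀, q₁) (rawGenerator EQ EG G q₀ ξ₀, rawGenerator EQ EG G q₁ ξ₀) = 0 :=
    rawDeriv_generator_eq_zero (mdifferentiableAt_upsilon P A (q₀, q₁))
      (fun g => upsilon_smul P A g _) ξ₀
  -- Subtracting the generator of `ξ₀` at both points leaves a vector at the second point only.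
  have h3 : ξ₁ - ξ₀ = 0 := by
    refine eq_zero_of_rawUpsilon_zero_generator P A (q₀ := q₀) (q₁ := q₁) ?_
    have h4 : ((0, rawGenerator EQ EG G q₁ (ξ₁ - ξ₀)) : EQ × EQ) =
        (rawGenerator EQ EG G q₀ ξ₀, rawGenerator EQ EG G q₁ ξ₁) -
          (rawGenerator EQ EG G q₀ ξ₀, rawGenerator EQ EG G q₁ ξ₀) := by simp
    rw [h4, map_sub, hv, h2, sub_zero]
  obtain rfl : ξ₁ = ξ₀ := sub_eq_zero.1 h3
  have h5 : ξ₁ = 0 := by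
    have : (2 : ℝ) • ξ₁ = 0 := by rw [two_smul]; exact hC
    simpa using this
  simp [h5]

end Reduction

/-! ### Discrete summation by parts -/

/-- The linear-algebra core of the discrete variational calculus: after summation by parts, a sum
of covectors over the edges of a discrete curve vanishes on all variations with fixed endpoints if
and only if the two covectors meeting at each interior point cancel. -/
theorem sum_edges_eq_zero_iff {E : Type*} [NormedAddCommGroup E] [NormedSpace ℝ E] {N : ℕ}
    (α : Fin N → E × E →L[ℝ] ℝ) :
    (∀ δ : Fin (N + 1) → E, δ 0 = 0 → δ (Fin.last N) = 0 →
        ∑ k : Fin N, α k (δ k.castSucc, δ k.succ) = 0) ↔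
      ∀ (k : ℕ) (h : k + 2 < N + 1) (v : E),
        α ⟨k, by omega⟩ (0, v) + α ⟨k + 1, by omega⟩ (v, 0) = 0 := by
  have hsplit : ∀ k (a b : E), α k (a, b) = α k (a, 0) + α k (0, b) := fun k a b => by
    rw [← map_add]; simp
  have hz : ∀ k, α k (0, 0) = 0 := fun k => map_zero (α k)
  cases N with
  | zero => exact ⟨fun _ k h => absurd h (by omega), fun _ δ _ _ => by simp⟩
  | succ n =>
    have hsum : ∀ δ : Fin (n + 2) → E, δ 0 = 0 → δ (Fin.last (n + 1)) = 0 →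
        ∑ k : Fin (n + 1), α k (δ k.castSucc, δ k.succ) =
          ∑ j : Fin n, (α j.castSucc (0, δ j.castSucc.succ) +
            α j.succ (δ j.castSucc.succ, 0)) := by
      intro δ h0 hN
      simp only [hsplit _ (δ _) (δ _), Finset.sum_add_distrib]
      rw [Fin.sum_univ_succ, Fin.sum_univ_castSucc (fun k : Fin (n + 1) => α k (0, δ k.succ))]
      rw [Fin.succ_last, hN, Fin.castSucc_zero, h0]
      simp [hz, add_comm]
    constructor
    · intro H k h v
      have hk : k < n := by omega
      -- The variation that moves only the interior point `k + 1`.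
      have h1 := H (Pi.single (⟨k, hk⟩ : Fin n).castSucc.succ v)
        (Pi.single_eq_of_ne (by simp [Fin.ext_iff]) _)
        (Pi.single_eq_of_ne (by simp [Fin.ext_iff]; omega) _)
      rw [hsum _ (Pi.single_eq_of_ne (by simp [Fin.ext_iff]) _)
        (Pi.single_eq_of_ne (by simp [Fin.ext_iff]; omega) _),
        Finset.sum_eq_single (⟨k, hk⟩ : Fin n)] at h1
      · rw [Pi.single_eq_same] at h1
        exact h1
      · intro j _ hj
        rw [Pi.single_eq_of_ne (by simpa [Fin.ext_iff] using hj)]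
        simp [hz]
      · simp
    · intro H δ h0 hN
      rw [hsum δ h0 hN]
      exact Finset.sum_eq_zero fun j _ => H j (by omega) _

section Systems

variable {EQ EB EG G Q : Type*}
  [NormedAddCommGroup EQ] [NormedSpace ℝ EQ]
  [NormedAddCommGroup EB] [NormedSpace ℝ EB]
  [NormedAddCommGroup EG] [NormedSpace ℝ EG]
  [TopologicalSpace Q] [ChartedSpace EQ Q]
  [Group G] [TopologicalSpace G] [ChartedSpace EG G]
  [MulAction G Q] [ChartedSpace EB (Base G Q)]
  [LieGroup 𝓘(ℝ, EG) ∞ G] [IsManifold 𝓘(ℝ, EQ) ∞ Q] [ContMDiffSMul 𝓘(ℝ, EG) 𝓘(ℝ, EQ) ∞ G Q]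
  [IsManifold 𝓘(ℝ, EB) ∞ (Base G Q)]

/-! ### The unreduced equations -/

section Unreduced

variable (S : ForcedDMS EQ Q)

/-- The differential of the discrete Lagrangian, between model spaces. -/
def ForcedDMS.rawDL (p : Q × Q) : EQ × EQ →L[ℝ] ℝ :=
  rawDeriv (𝓘(ℝ, EQ).prod 𝓘(ℝ, EQ)) 𝓘(ℝ, ℝ) S.L p

/-- The discrete force, as a covector on the model space. -/
def ForcedDMS.rawForce (p : Q × Q) : EQ × EQ →L[ℝ] ℝ := S.f p

theorem ForcedDMS.mdifferentiableAt_L (p : Q × Q) :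
    MDifferentiableAt (𝓘(ℝ, EQ).prod 𝓘(ℝ, EQ)) 𝓘(ℝ, ℝ) S.L p :=
  (S.contMDiff_L p).mdifferentiableAt (by simp)

theorem ForcedDMS.rawDeriv_action {N : ℕ} (q : Fin (N + 1) → Q) (δ : Fin (N + 1) → EQ) :
    rawDeriv (ModelWithCorners.pi fun _ : Fin (N + 1) => 𝓘(ℝ, EQ)) 𝓘(ℝ, ℝ) (S.action N) q δ =
      ∑ k : Fin N, S.rawDL (q k.castSucc, q k.succ) (δ k.castSucc, δ k.succ) := by
  have he := fun i : Fin (N + 1) => mdifferentiableAt_eval 𝓘(ℝ, EQ) i q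
  refine (rawDeriv_sum_comp _ (F := fun _ : Fin N => S.L)
    (g := fun (k : Fin N) (y : Fin (N + 1) → Q) => (y k.castSucc, y k.succ))
    (fun k => S.mdifferentiableAt_L _)
    (fun k => (he k.castSucc).prodMk (he k.succ)) δ).trans ?_
  refine Finset.sum_congr rfl fun k _ => ?_
  rw [rawDeriv_prodMk (he k.castSucc) (he k.succ), rawDeriv_eval, rawDeriv_eval]
  rfl

/-- The discrete Lagrange–d'Alembert principle says that the covectors `dL + f` on the edges of the
curve cancel on all variations with fixed endpoints. -/
theorem ForcedDMS.isTrajectory_iff {N : ℕ} (q : Fin (N + 1) → Q) :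
    S.IsTrajectory q ↔ ∀ δ : Fin (N + 1) → EQ, δ 0 = 0 → δ (Fin.last N) = 0 →
      ∑ k : Fin N, (S.rawDL (q k.castSucc, q k.succ) + S.rawForce (q k.castSucc, q k.succ))
        (δ k.castSucc, δ k.succ) = 0 := by
  refine forall_congr' fun δ => imp_congr_right fun _ => imp_congr_right fun _ => ?_
  simp only [add_apply, Finset.sum_add_distrib]
  rw [← S.rawDeriv_action q δ]
  rfl

/-- The covector in the forced discrete Euler–Lagrange equations at three consecutive points. -/
def ForcedDMS.rawDEL (q₀ q₁ q₂ : Q) : EQ →L[ℝ] ℝ :=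
  (S.rawDL (q₀, q₁) + S.rawForce (q₀, q₁)).comp (ContinuousLinearMap.inr ℝ EQ EQ) +
    (S.rawDL (q₁, q₂) + S.rawForce (q₁, q₂)).comp (ContinuousLinearMap.inl ℝ EQ EQ)

theorem ForcedDMS.satisfiesForcedDEL_iff {N : ℕ} (q : Fin (N + 1) → Q) :
    S.SatisfiesForcedDEL q ↔ ∀ (k : ℕ) (h : k + 2 < N + 1),
      S.rawDEL (q ⟨k, by omega⟩) (q ⟨k + 1, by omega⟩) (q ⟨k + 2, h⟩) = 0 := by
  refine forall_congr' fun k => forall_congr' fun h => ?_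
  have h1 : ∀ q₀ q₁ q₂ : Q, (S.D₂L q₀ q₁ + S.D₁L q₁ q₂ + S.fPlus q₀ q₁ + S.fMinus q₁ q₂ :
      EQ →L[ℝ] ℝ) = S.rawDEL q₀ q₁ q₂ := by
    intro q₀ q₁ q₂
    have h2 : S.rawDEL q₀ q₁ q₂ = (S.rawDL (q₀, q₁)).comp (ContinuousLinearMap.inr ℝ EQ EQ) +
      (S.rawDL (q₁, q₂)).comp (ContinuousLinearMap.inl ℝ EQ EQ) +
      (S.rawForce (q₀, q₁)).comp (ContinuousLinearMap.inr ℝ EQ EQ) +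
      (S.rawForce (q₁, q₂)).comp (ContinuousLinearMap.inl ℝ EQ EQ) := by
      ext v
      simp only [ForcedDMS.rawDEL, add_apply, ContinuousLinearMap.comp_apply]
      ring
    rw [h2]
    rfl
  exact Eq.congr (h1 _ _ _) rfl

theorem ForcedDMS.isTrajectory_iff_satisfiesForcedDEL {N : ℕ} (q : Fin (N + 1) → Q) :
    S.IsTrajectory q ↔ S.SatisfiesForcedDEL q := by
  rw [S.isTrajectory_iff, S.satisfiesForcedDEL_iff,
    sum_edges_eq_zero_iff fun k : Fin N =>
      S.rawDL (q k.castSucc, q k.succ) + S.rawForce (q k.castSucc, q k.succ)]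
  refine forall_congr' fun k => forall_congr' fun h => ?_
  rw [ContinuousLinearMap.ext_iff]
  exact Iff.rfl

end Unreduced

/-! ### The reduced variational principle -/

section ReducedPrinciple

variable (P : IsPrincipalBundle EQ EB EG G Q)
  (C : PrincipalConnection EQ EG G Q) (A : AffineDiscreteConnection EQ EB EG G Q)
  (S : ForcedDMS EQ Q) (hS : S.IsSymmetric G)

/-- The reduced Lagrangian has the same differential as the Lagrangian, along `Υ`. -/
theorem rawDeriv_Lhat (p : Q × Q) (v : EQ × EQ) :
    rawDeriv ((𝓘(ℝ, EB).prod 𝓘(ℝ, EG)).prod 𝓘(ℝ, EB)) 𝓘(ℝ, ℝ) (S.Lhat P A hS) (upsilon P A p)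
      (rawUpsilon P A p v) = S.rawDL p v := by
  have h := rawDeriv_eq_comp (k := S.L)
    ((contMDiff_Lhat P A S hS (upsilon P A p)).mdifferentiableAt (by simp))
    (mdifferentiableAt_upsilon P A p) rfl
    (Filter.Eventually.of_forall fun p => (Lhat_upsilon P A S hS p).symm)
  exact (DFunLike.congr_fun h v).symm

/-- The differential of the action of `g` on `Q × Q`. -/
theorem rawDeriv_smul_prod (P : IsPrincipalBundle EQ EB EG G Q) (g : G) (p : Q × Q) (v : EQ × EQ) :
    rawDeriv (𝓘(ℝ, EQ).prod 𝓘(ℝ, EQ)) (𝓘(ℝ, EQ).prod 𝓘(ℝ, EQ)) (fun p : Q × Q => g • p) p v =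
      (rawDeriv 𝓘(ℝ, EQ) 𝓘(ℝ, EQ) (fun q : Q => g • q) p.1 v.1,
        rawDeriv 𝓘(ℝ, EQ) 𝓘(ℝ, EQ) (fun q : Q => g • q) p.2 v.2) := by
  have h0 : MDifferentiableAt (𝓘(ℝ, EQ).prod 𝓘(ℝ, EQ)) 𝓘(ℝ, EQ) (Prod.fst : Q × Q → Q) p :=
    mdifferentiableAt_fst
  have h1 : MDifferentiableAt (𝓘(ℝ, EQ).prod 𝓘(ℝ, EQ)) 𝓘(ℝ, EQ) (Prod.snd : Q × Q → Q) p :=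
    mdifferentiableAt_snd
  have h2 := mdifferentiableAt_smul_right P g p.1
  have h3 := mdifferentiableAt_smul_right P g p.2
  have h4 := rawDeriv_prodMk (h2.comp p h0) (h3.comp p h1)
  refine (DFunLike.congr_fun h4 v).trans ?_
  rw [rawDeriv_eq_comp (k := (fun q : Q => g • q) ∘ Prod.fst) h2 h0 rfl Filter.EventuallyEq.rfl,
    rawDeriv_eq_comp (k := (fun q : Q => g • q) ∘ Prod.snd) h3 h1 rfl Filter.EventuallyEq.rfl,
    rawDeriv_fst, rawDeriv_snd]
  rfl

theorem mdifferentiableAt_smul_prod (P : IsPrincipalBundle EQ EB EG G Q) (g : G) (p : Q × Q) :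
    MDifferentiableAt (𝓘(ℝ, EQ).prod 𝓘(ℝ, EQ)) (𝓘(ℝ, EQ).prod 𝓘(ℝ, EQ))
      (fun p : Q × Q => g • p) p :=
  MDifferentiableAt.prodMk
    (MDifferentiableAt.comp p (mdifferentiableAt_smul_right P g p.1) mdifferentiableAt_fst)
    (MDifferentiableAt.comp p (mdifferentiableAt_smul_right P g p.2) mdifferentiableAt_snd)

theorem Ad_injective (g : G) : Function.Injective (Ad (G := G) EG g) :=
  Function.LeftInverse.injective (g := Ad (G := G) EG g⁻¹) fun ξ => by
    rw [← Ad_mul, inv_mul_cancel, Ad_one]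

/-- The value of the reduced force on the data coming from a tangent vector of `Q × Q`. Two tangent
vectors giving the same data differ by the action of some `g`, since `TΥ` and `½ (𝔄 + 𝔄)` together
separate the tangent vectors at a point; so symmetry makes the defining choice immaterial. -/
theorem fhat_upsilon (hS : S.IsSymmetric G) (p : Q × Q) (v : EQ × EQ)
    (X : TangentSpace ((𝓘(ℝ, EB).prod 𝓘(ℝ, EG)).prod 𝓘(ℝ, EB)) (upsilon P A p))
    (ξ : GroupLieAlgebra 𝓘(ℝ, EG) G) (hX : X = rawUpsilon P A p v)
    (hξ : ξ = C.pairForm p v) :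
    S.fhat P C A (upsilon P A p) X (AdjointFibre.mk P A p ξ) = S.rawForce p v := by
  subst hX hξ
  have hex : ∃ r : ℝ, ∃ (p' : Q × Q) (v' : TangentSpace (𝓘(ℝ, EQ).prod 𝓘(ℝ, EQ)) p'),
      tangentMap (𝓘(ℝ, EQ).prod 𝓘(ℝ, EQ)) ((𝓘(ℝ, EB).prod 𝓘(ℝ, EG)).prod 𝓘(ℝ, EB))
        (upsilon P A) ⟨p', v'⟩ = ⟨upsilon P A p, rawUpsilon P A p v⟩ ∧
      AdjointBundle.mk p' (C.pairForm p' v') =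
        (AdjointFibre.mk P A p (C.pairForm p v)).1 ∧ r = S.f p' v' :=
    ⟨S.f p v, p, v, rfl, rfl, rfl⟩
  -- The reduced force is thus computed from some `v'` at some `p'` with the same data.
  obtain ⟨p', v', h1, h2, h3⟩ := Classical.epsilon_spec hex
  refine h3.trans ?_
  have h4 : rawUpsilon P A p' v' = rawUpsilon P A p v :=
    congrArg (fun t : TangentBundle ((𝓘(ℝ, EB).prod 𝓘(ℝ, EG)).prod 𝓘(ℝ, EB))
      (ConjBundle P × Base G Q) => (t.2 : (EB × EG) × EB)) h1
  obtain ⟨g, hg⟩ : ∃ g : G, (g • p, Ad EG g (C.pairForm p v)) = (p', C.pairForm p' v') :=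
    Quotient.exact h2
  obtain ⟨rfl, h5⟩ := Prod.mk.inj hg
  -- `v'` is transported back to the point `p`.
  let u : EQ × EQ := rawDeriv (𝓘(ℝ, EQ).prod 𝓘(ℝ, EQ)) (𝓘(ℝ, EQ).prod 𝓘(ℝ, EQ))
    (fun p : Q × Q => g⁻¹ • p) (g • p) v'
  have hu : rawDeriv (𝓘(ℝ, EQ).prod 𝓘(ℝ, EQ)) (𝓘(ℝ, EQ).prod 𝓘(ℝ, EQ))
      (fun p : Q × Q => g • p) p u = v' :=
    rawDeriv_leftInverse (f := fun p : Q × Q => g⁻¹ • p) (x := g • p)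
      (mdifferentiableAt_smul_prod P g p)
      (mdifferentiableAt_smul_prod P g⁻¹ (g • p)) (inv_smul_smul g p)
      (Filter.Eventually.of_forall fun z => smul_inv_smul g z) v'
  have h6 : rawUpsilon P A p u = rawUpsilon P A p v := by
    rw [← h4, ← hu]
    have := rawDeriv_eq_comp (k := upsilon P A) (x := p) (f := fun p : Q × Q => g • p)
      (mdifferentiableAt_upsilon P A (g • p)) (mdifferentiableAt_smul_prod P g p) rfl
      (Filter.Eventually.of_forall fun z => (upsilon_smul P A g z).symm)
    exact DFunLike.congr_fun this u
  have h7 : C.pairForm p u = C.pairForm p v := by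
    refine Ad_injective g ?_
    rw [h5]
    have hu1 := (rawDeriv_smul_prod P g p u).symm.trans hu
    have e1 : C.rawForm (g • p.1) v'.1 = Ad EG g (C.rawForm p.1 u.1) := by
      rw [← hu1]; exact C.form_smul g p.1 u.1
    have e2 : C.rawForm (g • p.2) v'.2 = Ad EG g (C.rawForm p.2 u.2) := by
      rw [← hu1]; exact C.form_smul g p.2 u.2
    have e3 : C.pairForm (g • p) v' =
      (1 / 2 : ℝ) • (C.rawForm (g • p.1) v'.1 + C.rawForm (g • p.2) v'.2) := rfl
    rw [e3, e1, e2]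
    refine (map_smul (Ad (G := G) EG g) _ _).trans ?_
    rw [map_add]
    rfl
  have h8 : u - v = 0 := by
    refine eq_zero_of_rawUpsilon_eq_zero P C A (p := p) (by rw [map_sub, h6, sub_self]) ?_
    have e1 : (1 / 2 : ℝ) • (C.rawForm p.1 u.1 + C.rawForm p.2 u.2) =
      (1 / 2 : ℝ) • (C.rawForm p.1 v.1 + C.rawForm p.2 v.2) := h7
    have e2 := smul_right_injective EG (by norm_num : (1 / 2 : ℝ) ≠ 0) e1
    simp only [Prod.fst_sub, Prod.snd_sub, map_sub]
    rw [sub_add_sub_comm, sub_eq_zero]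
    exact e2
  have h9 := hS.f_smul g p u
  have h10 : S.rawForce (g • p) v' = S.rawForce p u := by
    rw [← hu]; exact h9
  rw [sub_eq_zero.1 h8] at h10
  exact h10

theorem rawDeriv_reducedAction {N : ℕ} (x : Fin N → ConjBundle P × Base G Q)
    (δ : Fin N → (EB × EG) × EB) :
    rawDeriv (ModelWithCorners.pi fun _ : Fin N => (𝓘(ℝ, EB).prod 𝓘(ℝ, EG)).prod 𝓘(ℝ, EB)) 𝓘(ℝ, ℝ)
        (S.reducedAction P A hS N) x δ =
      ∑ k : Fin N, rawDeriv ((𝓘(ℝ, EB).prod 𝓘(ℝ, EG)).prod 𝓘(ℝ, EB)) 𝓘(ℝ, ℝ) (S.Lhat P A hS)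
        (x k) (δ k) := by
  refine (rawDeriv_sum_comp _ (F := fun _ : Fin N => S.Lhat P A hS)
    (g := fun (k : Fin N) (y : Fin N → ConjBundle P × Base G Q) => y k)
    (fun k => (contMDiff_Lhat P A S hS _).mdifferentiableAt (by simp))
    (fun k => mdifferentiableAt_eval _ k x) δ).trans ?_
  refine Finset.sum_congr rfl fun k _ => ?_
  rw [rawDeriv_eval]
  rfl

/-- The reduced variational principle is the unreduced one for the variations
`δq_k = h(δτ_k) + (ξ_k)_Q(q_k)`. -/
theorem satisfiesReducedPrinciple_iff {N : ℕ} (q : Fin (N + 1) → Q) :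
    S.SatisfiesReducedPrinciple P C A hS q ↔
      ∀ (δτ : Fin (N + 1) → EB) (ξ : Fin (N + 1) → EG),
        δτ 0 = 0 → δτ (Fin.last N) = 0 → ξ 0 = 0 → ξ (Fin.last N) = 0 →
        ∑ k : Fin N, (S.rawDL (q k.castSucc, q k.succ) + S.rawForce (q k.castSucc, q k.succ))
          (rawLift P C (q k.castSucc) (δτ k.castSucc) +
            rawGenerator EQ EG G (q k.castSucc) (ξ k.castSucc),
           rawLift P C (q k.succ) (δτ k.succ) +
            rawGenerator EQ EG G (q k.succ) (ξ k.succ)) = 0 := by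
  have main : ∀ (δτ : Fin (N + 1) → EB) (δv : Fin N → EB × EG) (ξ : Fin (N + 1) → EG),
      (∀ k : Fin N, δv k =
        ((rhoVariation P A (q k.castSucc) (q k.succ)
          (rawLift P C (q k.castSucc) (δτ k.castSucc)) (rawLift P C (q k.succ) (δτ k.succ)) :
            EB × EG) +
        (rhoVariation P A (q k.castSucc) (q k.succ)
          (rawGenerator EQ EG G (q k.castSucc) (ξ k.castSucc))
          (rawGenerator EQ EG G (q k.succ) (ξ k.succ)) : EB × EG))) →
      rawDeriv (ModelWithCorners.pi fun _ : Fin N => (𝓘(ℝ, EB).prod 𝓘(ℝ, EG)).prod 𝓘(ℝ, EB))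
        𝓘(ℝ, ℝ) (S.reducedAction P A hS N) (fun k => upsilon P A (q k.castSucc, q k.succ))
        (fun k => (δv k, δτ k.succ)) +
      ∑ k : Fin N, S.fhat P C A (upsilon P A (q k.castSucc, q k.succ))
        ((δv k, δτ k.succ) : (EB × EG) × EB)
        (AdjointFibre.mk P A (q k.castSucc, q k.succ)
          ((1 / 2 : ℝ) • (ξ k.castSucc + ξ k.succ) : EG)) =
      ∑ k : Fin N, (S.rawDL (q k.castSucc, q k.succ) + S.rawForce (q k.castSucc, q k.succ))
          (rawLift P C (q k.castSucc) (δτ k.castSucc) +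
            rawGenerator EQ EG G (q k.castSucc) (ξ k.castSucc),
           rawLift P C (q k.succ) (δτ k.succ) +
            rawGenerator EQ EG G (q k.succ) (ξ k.succ)) := by
    intro δτ δv ξ hδv
    rw [rawDeriv_reducedAction P A S hS, ← Finset.sum_add_distrib]
    refine Finset.sum_congr rfl fun k _ => ?_
    set a := rawLift P C (q k.castSucc) (δτ k.castSucc) with ha
    set b := rawLift P C (q k.succ) (δτ k.succ) with hb
    set c := rawGenerator EQ EG G (q k.castSucc) (ξ k.castSucc) with hc
    set d := rawGenerator EQ EG G (q k.succ) (ξ k.succ) with hd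
    have h1 : rawUpsilon P A (q k.castSucc, q k.succ) (a + c, b + d) = (δv k, δτ k.succ) := by
      have e : ((a + c, b + d) : EQ × EQ) = (a, b) + (c, d) := rfl
      rw [e, map_add, rawUpsilon_apply, rawUpsilon_apply, hδv k, hb, hd, rawProj_rawLift,
        rawProj_rawGenerator P]
      exact Prod.ext rfl (add_zero _)
    have h2 : ((1 / 2 : ℝ) • (ξ k.castSucc + ξ k.succ) : EG) =
        C.pairForm (q k.castSucc, q k.succ) ((a + c, b + d) : EQ × EQ) := by
      have e : (C.pairForm (q k.castSucc, q k.succ) ((a + c, b + d) : EQ × EQ) : EG) =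
        (1 / 2 : ℝ) • (C.rawForm (q k.castSucc) (a + c) + C.rawForm (q k.succ) (b + d)) := rfl
      rw [e, map_add, map_add, ha, hb, hc, hd]
      simp only [rawForm_rawLift, rawForm_rawGenerator, zero_add]
    rw [fhat_upsilon P C A S hS _ _ _ _ h1.symm h2, ← h1, rawDeriv_Lhat]
    rfl
  constructor
  · intro H δτ ξ h0 hN g0 gN
    exact (main δτ _ ξ fun k => rfl).symm.trans (H δτ _ ξ (fun k => rfl) h0 hN g0 gN)
  · intro H δτ δv ξ hδv h0 hN g0 gN
    exact (main δτ δv ξ hδv).trans (H δτ ξ h0 hN g0 gN)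

theorem isTrajectory_iff_satisfiesReducedPrinciple {N : ℕ} (q : Fin (N + 1) → Q) :
    S.IsTrajectory q ↔ S.SatisfiesReducedPrinciple P C A hS q := by
  rw [S.isTrajectory_iff, satisfiesReducedPrinciple_iff]
  constructor
  · intro H δτ ξ h0 hN g0 gN
    exact H (fun k => rawLift P C (q k) (δτ k) + rawGenerator EQ EG G (q k) (ξ k))
      (by simp [h0, g0]) (by simp [hN, gN])
  · intro H δ h0 hN
    have h := H (fun k => rawProj EQ EB G (q k) (δ k)) (fun k => C.rawForm (q k) (δ k))
      (by simp [h0]) (by simp [hN]) (by simp [h0]) (by simp [hN])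
    simpa only [rawLift_add_rawGenerator] using h

end ReducedPrinciple

/-! ### The reduced equations -/

section ReducedEquations

variable (P : IsPrincipalBundle EQ EB EG G Q)
  (C : PrincipalConnection EQ EG G Q) (A : AffineDiscreteConnection EQ EB EG G Q)
  (S : ForcedDMS EQ Q)

/-- The map `(q₀, q₁) ↦ (q₀, 𝒜_d(q₀, q₁), π(q₁))`, of which `psiTilde A` is the inverse. -/
def phiTilde (p : Q × Q) : Q × G × Base G Q := (p.1, A.form p, proj G p.2)

/-- The differential `(δq₀, δq₁) ↦ (δq₀, T𝒜_d(δq₀, δq₁), Tπ(δq₁))` of `phiTilde A`, between model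
spaces. -/
def rawPhi (p : Q × Q) : EQ × EQ →L[ℝ] EQ × EG × EB :=
  (ContinuousLinearMap.fst ℝ EQ EQ).prod
    ((A.rawForm p).prod ((rawProj EQ EB G p.2).comp (ContinuousLinearMap.snd ℝ EQ EQ)))

/-- `dĽ` at the image of `(q₀, q₁)`, between model spaces. -/
def ForcedDMS.rawDLcheck (q₀ q₁ : Q) : EQ × EG × EB →L[ℝ] ℝ :=
  rawDeriv (𝓘(ℝ, EQ).prod (𝓘(ℝ, EG).prod 𝓘(ℝ, EB))) 𝓘(ℝ, ℝ) (S.Lcheck A)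
    (q₀, A.form (q₀, q₁), proj G q₁)

/-- `f̌` at the image of `(q₀, q₁)`, as a covector on the model space. -/
def ForcedDMS.rawFcheck (q₀ q₁ : Q) : EQ × EG × EB →L[ℝ] ℝ :=
  S.fcheck A (q₀, A.form (q₀, q₁), proj G q₁)

theorem mdifferentiableAt_phiTilde (P : IsPrincipalBundle EQ EB EG G Q) (p : Q × Q) :
    MDifferentiableAt (𝓘(ℝ, EQ).prod 𝓘(ℝ, EQ)) (𝓘(ℝ, EQ).prod (𝓘(ℝ, EG).prod 𝓘(ℝ, EB)))
      (phiTilde A) p :=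
  mdifferentiableAt_fst.prodMk ((mdifferentiableAt_form P A p).prodMk
    (MDifferentiableAt.comp p (mdifferentiableAt_proj P p.2) mdifferentiableAt_snd))

theorem rawDeriv_phiTilde (P : IsPrincipalBundle EQ EB EG G Q) (p : Q × Q) :
    rawDeriv (𝓘(ℝ, EQ).prod 𝓘(ℝ, EQ)) (𝓘(ℝ, EQ).prod (𝓘(ℝ, EG).prod 𝓘(ℝ, EB)))
      (phiTilde A) p = rawPhi A p := by
  have h0 : MDifferentiableAt (𝓘(ℝ, EQ).prod 𝓘(ℝ, EQ)) 𝓘(ℝ, EQ) (Prod.fst : Q × Q → Q) p :=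
    mdifferentiableAt_fst
  have h1 : MDifferentiableAt (𝓘(ℝ, EQ).prod 𝓘(ℝ, EQ)) 𝓘(ℝ, EQ) (Prod.snd : Q × Q → Q) p :=
    mdifferentiableAt_snd
  have h2 := mdifferentiableAt_form P A p
  have h3 := mdifferentiableAt_proj P p.2
  have h4 : MDifferentiableAt (𝓘(ℝ, EQ).prod 𝓘(ℝ, EQ)) 𝓘(ℝ, EB)
      (fun p : Q × Q => (proj G p.2 : Base G Q)) p := h3.comp p h1
  have h5 := rawDeriv_prodMk h0 (h2.prodMk h4)
  rw [rawDeriv_prodMk h2 h4, rawDeriv_fst,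
    rawDeriv_eq_comp (k := fun p : Q × Q => (proj G p.2 : Base G Q)) h3 h1 rfl
      Filter.EventuallyEq.rfl, rawDeriv_snd] at h5
  exact h5

theorem rawDLcheck_comp_rawPhi (P : IsPrincipalBundle EQ EB EG G Q) (q₀ q₁ : Q) :
    (S.rawDLcheck A q₀ q₁).comp (rawPhi A (q₀, q₁)) = S.rawDL (q₀, q₁) := by
  have h1 := mdifferentiableAt_phiTilde A P (q₀, q₁)
  have h2 := rawDeriv_phiTilde A P (q₀, q₁)
  have h3 : MDifferentiableAt (𝓘(ℝ, EQ).prod (𝓘(ℝ, EG).prod 𝓘(ℝ, EB))) 𝓘(ℝ, ℝ) (S.Lcheck A)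
      (q₀, A.form (q₀, q₁), proj G q₁) :=
    (S.contMDiff_L.comp A.contMDiff_psiTilde).contMDiffAt.mdifferentiableAt (by simp)
  rw [← h2]
  exact (rawDeriv_eq_comp (k := S.L) h3 h1 rfl
    (Filter.Eventually.of_forall fun p => congrArg S.L (psiTilde_form A p.1 p.2).symm)).symm

theorem rawFcheck_comp_rawPhi (P : IsPrincipalBundle EQ EB EG G Q) (q₀ q₁ : Q) :
    (S.rawFcheck A q₀ q₁).comp (rawPhi A (q₀, q₁)) = S.rawForce (q₀, q₁) := by
  have h1 := mdifferentiableAt_phiTilde A P (q₀, q₁)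
  have h2 := rawDeriv_phiTilde A P (q₀, q₁)
  have h3 : MDifferentiableAt (𝓘(ℝ, EQ).prod (𝓘(ℝ, EG).prod 𝓘(ℝ, EB))) (𝓘(ℝ, EQ).prod 𝓘(ℝ, EQ))
      (psiTilde A) (q₀, A.form (q₀, q₁), proj G q₁) :=
    (A.contMDiff_psiTilde _).mdifferentiableAt (by simp)
  refine ContinuousLinearMap.ext fun v => ?_
  have h4 := rawDeriv_leftInverse h3 h1 rfl
    (Filter.Eventually.of_forall fun p => psiTilde_form A p.1 p.2) v
  rw [h2] at h4
  have h5 : S.rawFcheck A q₀ q₁ = (S.rawForce (psiTilde A (q₀, A.form (q₀, q₁), proj G q₁))).comp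
    (rawDeriv (𝓘(ℝ, EQ).prod (𝓘(ℝ, EG).prod 𝓘(ℝ, EB))) (𝓘(ℝ, EQ).prod 𝓘(ℝ, EQ))
      (psiTilde A) (q₀, A.form (q₀, q₁), proj G q₁)) := rfl
  rw [h5, psiTilde_form, ContinuousLinearMap.comp_apply, ContinuousLinearMap.comp_apply, h4]

theorem map_prod_prod_eq_add {E₁ E₂ E₃ F : Type*} [NormedAddCommGroup E₁] [NormedSpace ℝ E₁]
    [NormedAddCommGroup E₂] [NormedSpace ℝ E₂] [NormedAddCommGroup E₃] [NormedSpace ℝ E₃]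
    [NormedAddCommGroup F] [NormedSpace ℝ F] (β : E₁ × E₂ × E₃ →L[ℝ] F) (a : E₁) (b : E₂) (c : E₃) :
    β (a, b, c) = β (a, 0, 0) + β (0, b, 0) + β (0, 0, c) := by
  rw [← map_add, ← map_add]; simp

/-- The covector `φ` is the forced discrete Euler–Lagrange covector on horizontal vectors. -/
theorem phi_apply (q₀ q₁ q₂ : Q) (w : EB) :
    (S.phi P C A q₀ q₁ q₂ : EB →L[ℝ] ℝ) w = S.rawDEL q₀ q₁ q₂ (rawLift P C q₁ w) := by
  set h := rawLift P C q₁ w with hh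
  have e : (S.phi P C A q₀ q₁ q₂ : EB →L[ℝ] ℝ) w =
      S.rawDLcheck A q₁ q₂ (h, 0, 0) + S.rawDLcheck A q₀ q₁ (0, 0, w)
      + S.rawDLcheck A q₁ q₂ (0, A.rawForm (q₁, q₂) (h, 0), 0)
      + S.rawDLcheck A q₀ q₁ (0, A.rawForm (q₀, q₁) (0, h), 0)
      + S.rawFcheck A q₁ q₂ (h, 0, 0) + S.rawFcheck A q₀ q₁ (0, 0, w)
      + S.rawFcheck A q₁ q₂ (0, A.rawForm (q₁, q₂) (h, 0), 0)
      + S.rawFcheck A q₀ q₁ (0, A.rawForm (q₀, q₁) (0, h), 0) := rfl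
  have e1 : rawPhi A (q₁, q₂) (h, 0) = (h, A.rawForm (q₁, q₂) (h, 0), 0) :=
    Prod.ext rfl (Prod.ext rfl (map_zero (rawProj EQ EB G q₂)))
  have e2 : rawPhi A (q₀, q₁) (0, h) = (0, A.rawForm (q₀, q₁) (0, h), w) :=
    Prod.ext rfl (Prod.ext rfl (rawProj_rawLift P C q₁ w))
  rw [e, ForcedDMS.rawDEL, ← rawDLcheck_comp_rawPhi A S P, ← rawDLcheck_comp_rawPhi A S P,
    ← rawFcheck_comp_rawPhi A S P, ← rawFcheck_comp_rawPhi A S P]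
  simp only [add_apply, ContinuousLinearMap.comp_apply, ContinuousLinearMap.inr_apply,
    ContinuousLinearMap.inl_apply, e1, e2]
  rw [map_prod_prod_eq_add (S.rawDLcheck A q₁ q₂) h (A.rawForm (q₁, q₂) (h, 0)) 0,
    map_prod_prod_eq_add (S.rawFcheck A q₁ q₂) h (A.rawForm (q₁, q₂) (h, 0)) 0,
    map_prod_prod_eq_add (S.rawDLcheck A q₀ q₁) 0 (A.rawForm (q₀, q₁) (0, h)) w,
    map_prod_prod_eq_add (S.rawFcheck A q₀ q₁) 0 (A.rawForm (q₀, q₁) (0, h)) w]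
  simp only [Prod.mk_zero_zero, map_zero]
  ring

/-- The covector `ψ` is the forced discrete Euler–Lagrange covector on vertical vectors. The
Lagrangian terms come from the invariance `D₁L(ξ_Q(q₁)) = - D₂L(ξ_Q(q₂))` of `L` at `(q₁, q₂)` and
from `D₂𝒜_d(q₀, q₁)(ξ_Q(q₁)) = ξ 𝒜_d(q₀, q₁)`. -/
theorem psi_apply (P : IsPrincipalBundle EQ EB EG G Q)
    (hS : S.IsSymmetric G) (q₀ q₁ q₂ : Q) (ξ : EG) :
    (S.psi A q₀ q₁ q₂ : EG →L[ℝ] ℝ) ξ = S.rawDEL q₀ q₁ q₂ (rawGenerator EQ EG G q₁ ξ) := by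
  set h := rawGenerator EQ EG G q₁ ξ with hh
  set h₂ := rawGenerator EQ EG G q₂ ξ with hh₂
  have e : (S.psi A q₀ q₁ q₂ : EG →L[ℝ] ℝ) ξ =
      S.rawDLcheck A q₀ q₁
        (0, rawDeriv 𝓘(ℝ, EG) 𝓘(ℝ, EG) (fun g : G => g * A.form (q₀, q₁)) 1 ξ, 0)
      - S.rawDLcheck A q₁ q₂
        (0, rawDeriv 𝓘(ℝ, EG) 𝓘(ℝ, EG) (fun g : G => g * A.form (q₁, q₂)) 1 ξ, 0)
      + (S.rawFcheck A q₁ q₂ (h, 0, 0)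
        + S.rawFcheck A q₁ q₂ (0, A.rawForm (q₁, q₂) (h, 0), 0)
        + S.rawFcheck A q₀ q₁ (0, A.rawForm (q₀, q₁) (0, h), 0)) := rfl
  have e1 : rawPhi A (q₁, q₂) (h, 0) = (h, A.rawForm (q₁, q₂) (h, 0), 0) :=
    Prod.ext rfl (Prod.ext rfl (map_zero (rawProj EQ EB G q₂)))
  have e2 : rawPhi A (q₀, q₁) (0, h) = (0, A.rawForm (q₀, q₁) (0, h), 0) :=
    Prod.ext rfl (Prod.ext rfl (rawProj_rawGenerator P q₁ ξ))
  have e3 : rawPhi A (q₁, q₂) (0, h₂) = (0, A.rawForm (q₁, q₂) (0, h₂), 0) :=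
    Prod.ext rfl (Prod.ext rfl (rawProj_rawGenerator P q₂ ξ))
  have e4 : S.rawDL (q₁, q₂) (h, 0) = - S.rawDL (q₁, q₂) (0, h₂) := by
    have := rawDeriv_generator_eq_zero (S.mdifferentiableAt_L (q₁, q₂))
      (fun g : G => hS.L_smul g (q₁, q₂)) ξ
    have e5 : S.rawDL (q₁, q₂) (h, h₂) = 0 := this
    rw [eq_neg_iff_add_eq_zero, ← map_add, ← e5]
    simp
  rw [e, ← rawForm_zero_generator P, ← rawForm_zero_generator P, ← hh, ← hh₂, ← e2, ← e3]
  simp only [ForcedDMS.rawDEL, add_apply, ContinuousLinearMap.comp_apply,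
    ContinuousLinearMap.inr_apply, ContinuousLinearMap.inl_apply, e4]
  rw [← rawDLcheck_comp_rawPhi A S P, ← rawDLcheck_comp_rawPhi A S P, ← rawFcheck_comp_rawPhi A S P,
    ← rawFcheck_comp_rawPhi A S P]
  simp only [ContinuousLinearMap.comp_apply, e1]
  rw [map_prod_prod_eq_add (S.rawFcheck A q₁ q₂) h (A.rawForm (q₁, q₂) (h, 0)) 0]
  simp only [Prod.mk_zero_zero, map_zero]
  ring

theorem satisfiesForcedDEL_iff_satisfiesReducedEquations (hS : S.IsSymmetric G) {N : ℕ}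
    (q : Fin (N + 1) → Q) :
    S.SatisfiesForcedDEL q ↔ S.SatisfiesReducedEquations P C A q := by
  rw [S.satisfiesForcedDEL_iff]
  refine forall_congr' fun k => forall_congr' fun h => ?_
  generalize (q ⟨k, by omega⟩) = q₀
  generalize (q ⟨k + 1, by omega⟩) = q₁
  generalize (q ⟨k + 2, h⟩) = q₂
  have hφ := phi_apply P C A S q₀ q₁ q₂
  have hψ := psi_apply A S P hS q₀ q₁ q₂
  constructor
  · intro H
    refine ⟨?_, fun ξ => ?_⟩
    · refine ContinuousLinearMap.ext fun w => (hφ w).trans ?_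
      rw [H]; rfl
    · refine (hψ ξ).trans ?_
      rw [H]; rfl
  · rintro ⟨h1, h2⟩
    ext v
    rw [← rawLift_add_rawGenerator P C q₁ v, map_add, ← hφ, ← hψ]
    have h3 := DFunLike.congr_fun h1 (rawProj EQ EB G q₁ v)
    have h4 := h2 (C.rawForm q₁ v)
    exact (congrArg₂ (· + ·) h3 h4).trans (add_zero _)

end ReducedEquations

end Systems

end DiscreteReduction

end

open DiscreteReduction in
theorem mainTheorem6 {EQ EB EG G Q : Type*}
    [NormedAddCommGroup EQ] [NormedSpace ℝ EQ] [FiniteDimensional ℝ EQ]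
    [NormedAddCommGroup EB] [NormedSpace ℝ EB] [FiniteDimensional ℝ EB]
    [NormedAddCommGroup EG] [NormedSpace ℝ EG] [FiniteDimensional ℝ EG]
    [TopologicalSpace Q] [ChartedSpace EQ Q] [IsManifold 𝓘(ℝ, EQ) ∞ Q]
    [Group G] [TopologicalSpace G] [ChartedSpace EG G] [LieGroup 𝓘(ℝ, EG) ∞ G]
    [MulAction G Q] [ContMDiffSMul 𝓘(ℝ, EG) 𝓘(ℝ, EQ) ∞ G Q]
    [ChartedSpace EB (Base G Q)] [IsManifold 𝓘(ℝ, EB) ∞ (Base G Q)]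
    (P : IsPrincipalBundle EQ EB EG G Q)
    (C : PrincipalConnection EQ EG G Q)
    (A : AffineDiscreteConnection EQ EB EG G Q)
    (S : ForcedDMS EQ Q) (hS : S.IsSymmetric G)
    (N : ℕ) (q : Fin (N + 1) → Q) :
    List.TFAE
      [S.IsTrajectory q,
       S.SatisfiesForcedDEL q,
       S.SatisfiesReducedPrinciple P C A hS q,
       S.SatisfiesReducedEquations P C A q] := by
  tfae_have 1 ↔ 2 := S.isTrajectory_iff_satisfiesForcedDEL q
  tfae_have 1 ↔ 3 := isTrajectory_iff_satisfiesReducedPrinciple P C A S hS q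
  tfae_have 2 ↔ 4 := satisfiesForcedDEL_iff_satisfiesReducedEquations P C A S hS q
  tfae_finish
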